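/- Let $p$ be a prime with $p\equiv 3 \pmod 4$, let $n$ be an odd positive integer, $q=p^n$, and let $V=\mathbb F_q^3$ be the space of column vectors. For $x\in\mathbb F_q$ put $$E(x)=\begin{pmatrix}1&x&x^2/2\\0&1&x\\0&0&1\end{pmatrix},$$ and let $A=ES\le \mathrm{GL}_3(\mathbb F_q)$, where $E=\{E(x)\mid x\in\mathbb F_q\}$ and $S=\{sI_3\mid s \text{ a nonzero square in } \mathbb F_q\}$. Let $\mathrm{Aut}(V)$ be the group of all automorphisms of the additive group of $V$, so that $A\le \mathrm{Aut}(V)$, and let $N_{\mathrm{Aut}(V)}(A)$ be the normalizer of $A$ in it. A subset $D\subseteq V$ is a difference set if, for some integer $\lambda\ge 0$ and $k=|D|$, the equation $\underline{D}\,\underline{-D}=(k-\lambda)\,1+\lambda\,\underline{V}$ holds in the integral group ring of $(V,+)$, where $\underline{X}$ is the sum of the elements of $X$ and $1$ is the identity of the group ring; it is a skew Hadamard difference set if, moreover, $V\setminus\{0\}$ is the disjoint union of $D$ and $-D$. The translation design $\mathrm{dev}(D)$ has point set $V$ and block set $\{D+h\mid h\in V\}$. An isomorphism from $\mathrm{dev}(D)$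 to $\mathrm{dev}(D')$ is a permutation of $V$ that maps the block set of $\mathrm{dev}(D)$ onto the block set of $\mathrm{dev}(D')$. Theorem. Let $D$ and $D'$ be skew Hadamard difference sets in $V$ that are $A$-invariant (unions of $A$-orbits). Then $\mathrm{dev}(D)$ and $\mathrm{dev}(D')$ are isomorphic if and only if some element of $N_{\mathrm{Aut}(V)}(A)$ is an isomorphism from $\mathrm{dev}(D)$ to $\mathrm{dev}(D')$. -/

import Mathlib

noncomputable section

namespace SkewHadamard

open scoped Pointwise

section Designs

variable {H : Type*} [AddCommGroup H] [Finite H]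

/-- The element `∑ d ∈ D, d` of the integral group ring of the (additively written) finite
abelian group `H`. -/
def groupRingSum (D : Set H) : AddMonoidAlgebra ℤ H :=
  ∑ d ∈ (Set.toFinite D).toFinset, AddMonoidAlgebra.single d 1

/-- `D` is a `(v, k, l)`-difference set in `H`: `v = |H|`, `k = |D|`, and in the integral group
ring `D * D^(-1) = (k - l) * 1 + l * H`. -/
def IsDifferenceSet (v k l : ℕ) (D : Set H) : Prop :=
  v = Nat.card H ∧ k = D.ncard ∧
    groupRingSum D * groupRingSum (-D) =
      ((k : ℤ) - (l : ℤ)) • (1 : AddMonoidAlgebra ℤ H) + (l : ℤ) • groupRingSum (Set.univ : Set H)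

/-- Skew Hadamard difference sets: difference sets `D` such that `H \ {0}` is the disjoint union
of `D` and `-D`. -/
def IsSkewHadamardDifferenceSet (D : Set H) : Prop :=
  (∃ v k l : ℕ, IsDifferenceSet v k l D) ∧ D ∪ -D = {0}ᶜ ∧ D ∩ -D = ∅

/-- The block set `{D + h | h ∈ H}` of the translation design generated by `D`; its point set
is `H`. -/
def dev (D : Set H) : Set (Set H) :=
  {B | ∃ h : H, B = (fun x => x + h) '' D}

end Designs

/-- The bijection `g` of the point sets is an isomorphism from the design with block set `𝓑` to
the design with block set `𝓑'`: it maps the blocks of the first onto the blocks of the second. -/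
def IsDesignIso {P P' : Type*} (g : P ≃ P') (𝓑 : Set (Set P)) (𝓑' : Set (Set P')) : Prop :=
  (fun B : Set P => g '' B) '' 𝓑 = 𝓑'

/-- Two designs, given by their block sets, are isomorphic. -/
def DesignsIsomorphic {P P' : Type*} (𝓑 : Set (Set P)) (𝓑' : Set (Set P')) : Prop :=
  ∃ g : P ≃ P', IsDesignIso g 𝓑 𝓑'

section GroupA

variable (F : Type*) [Field F]

/-- The space `V = F³` of column vectors. -/
abbrev V : Type _ := Fin 3 → F

variable {F} in
/-- The matrix `E(x)`, an element of `GL₃(F)`. -/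
def matE (x : F) : GL (Fin 3) F :=
  Matrix.GeneralLinearGroup.mkOfDetNeZero
    !![1, x, x ^ 2 / 2;
       0, 1, x;
       0, 0, 1] (by simp [Matrix.det_fin_three])

/-- The group `A = E S ≤ GL₃(F)` generated by `E = {E(x) | x ∈ F}` and by the group `S` of the
scalar matrices `s I₃` with `s` a nonzero square. -/
def groupA : Subgroup (GL (Fin 3) F) :=
  Subgroup.closure (Set.range (matE (F := F))) ⊔
    (Subgroup.square Fˣ).map (Matrix.GeneralLinearGroup.scalar (Fin 3))

/-- `Aut(V)`, the group (under composition) of all automorphisms of the additive group of `V`. -/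
abbrev AutV : Type _ := Multiplicative (AddAut (V F))

/-- `A` as a subgroup of `Aut(V)`, a matrix acting on column vectors from the left. -/
def groupAInAut : Subgroup (AutV F) :=
  (groupA F).map (DistribMulAction.toAddAut (GL (Fin 3) F) (V F))

/-- The permutation of `V` underlying an automorphism of `V`. -/
def AutV.toPerm {F : Type*} [Field F] (g : AutV F) : Equiv.Perm (V F) :=
  (Multiplicative.toAdd g).toEquiv

/-- The `A`-invariant skew Hadamard difference sets in `V`. -/
def invariantSHDS [Finite F] : Set (Set (V F)) :=
  {D | IsSkewHadamardDifferenceSet D ∧ ∀ a ∈ groupAInAut F, AutV.toPerm a '' D = D}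

end GroupA

end SkewHadamard

end

/-! Write T for the translations of V. Both E and T act on dev(D) and dev(D'). Given an isomorphism
g, Sylow's theorem in Aut(dev(D')) places ET and a conjugate of gETg⁻¹ in one p-group P; so after
composing with an automorphism, g carries ET into P. The isomorphism is then improved in two rounds:
first it is made to normalize T, hence additive after a translation, and then it is shown to
normalize E. A skew Hadamard difference set is far from translation invariant, so the additive
isomorphism maps D onto D' itself.

Both rounds use one principle. If an abelian subgroup H of a p-group P contains every abelian normal
subgroup of N_P(H), then H is normal in P and is the largest abelian normal subgroup there, so it
equals any conjugate of itself in P with the same property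
(`mem_normalizer_of_containsAbelianNormal`). It is applied to T in P, then to E in the stabilizer of
0 in P.

The hypothesis is verified through `IsInvariantSHDS.eq_of_commute_eAct`: an automorphism of V that
preserves D and commutes with E lies in A. Commuting with E leaves only multiples of E(t) and shears
(x, y, z) ↦ (x + c(z), y, z); counting D in planes z = const modulo p excludes the shears. An
element u of an abelian normal subgroup satisfies (u - 1)² = 0, on V or on E, and this is too strong
for an element outside T or E.

Finally, since A consists of the maps that preserve D and centralize E, an f that normalizes E and
maps D onto D' normalizes A. -/

namespace SkewHadamard

open scoped Pointwise

/-! ### Abelian normal subgroups of p-groups -/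

section GroupTheory

variable {Γ : Type*} [Group Γ] [Finite Γ] {p : ℕ} [Fact p.Prime]

/-- A nontrivial subgroup normalized by a `p`-group that contains it has a nontrivial element
centralized by the `p`-group. -/
theorem exists_central_of_normalized {Q B : Subgroup Γ} (hQ : IsPGroup p Q) (hBQ : B ≤ Q)
    (hB : Q ≤ Subgroup.normalizer (B : Set Γ)) (hne : B ≠ ⊥) :
    ∃ u ∈ B, u ≠ 1 ∧ ∀ x ∈ Q, x * u = u * x := by
  have hBp : IsPGroup p B := hQ.to_le hBQ
  obtain ⟨k, hk0, hk⟩ := hBp.exists_card_eq.imp fun k hk => by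
    refine (⟨?_, hk⟩ : k ≠ 0 ∧ Nat.card B = p ^ k)
    rintro rfl
    exact hne (Subgroup.card_eq_one.1 (by simpa using hk))
  let act : MulAction Q B :=
    { smul := fun x b => ⟨x * b * (x : Γ)⁻¹, (Subgroup.mem_normalizer_iff.1 (hB x.2) b).1 b.2⟩
      one_smul := fun b => Subtype.ext (by change 1 * (b : Γ) * 1⁻¹ = b; simp)
      mul_smul := fun x y b => Subtype.ext (by
        change (x * y : Γ) * b * (x * y : Γ)⁻¹ = x * (y * b * (y : Γ)⁻¹) * (x : Γ)⁻¹
        group) }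
  have h1 : (1 : B) ∈ MulAction.fixedPoints Q B := fun x => Subtype.ext (by
    change (x : Γ) * 1 * (x : Γ)⁻¹ = 1
    simp)
  -- The number of fixed points is congruent to |B|, hence to 0, modulo `p`; as 1 is fixed, there is
  -- another fixed point.
  obtain ⟨u, hu, hu1⟩ := hQ.exists_fixed_point_of_prime_dvd_card_of_fixed_point B
    (by rw [hk]; exact dvd_pow_self p hk0) h1
  refine ⟨u, u.2, fun h => hu1 (Subtype.ext h.symm), fun x hx => ?_⟩
  have := congrArg Subtype.val (hu ⟨x, hx⟩)
  change x * u * x⁻¹ = u at this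
  exact mul_inv_eq_iff_eq_mul.1 this

/-- If an abelian subgroup `H` of a finite `p`-group `P` contains all abelian normal subgroups of
`N_P(H)`, then it is normal in `P`. -/
theorem le_normalizer_of_abelian_normal_le {P H : Subgroup Γ} (hP : IsPGroup p P) (hHP : H ≤ P)
    (hab : ∀ x ∈ H, ∀ y ∈ H, x * y = y * x)
    (hmax : ∀ B : Subgroup Γ, B ≤ P ⊓ Subgroup.normalizer (H : Set Γ) →
      (P ⊓ Subgroup.normalizer (H : Set Γ) ≤ Subgroup.normalizer (B : Set Γ)) →
      (∀ x ∈ B, ∀ y ∈ B, x * y = y * x) → B ≤ H) :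
    P ≤ Subgroup.normalizer (H : Set Γ) := by
  set R := P ⊓ Subgroup.normalizer (H : Set Γ) with hR
  have hHR : H ≤ R := le_inf hHP Subgroup.le_normalizer
  -- If x normalizes R, the conjugate of H by x is again abelian and normal in R, so it is H. Thus R
  -- is its own normalizer in the nilpotent group P, which forces R = P.
  have hnorm : ∀ x ∈ P, (∀ y, y ∈ R ↔ x * y * x⁻¹ ∈ R) → x ∈ R := by
    intro x hx hxR
    have hmap : H.map (MulAut.conj x).toMonoidHom ≤ H := by
      apply hmax
      · rintro _ ⟨y, hy, rfl⟩
        exact (hxR y).1 (hHR hy)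
      · intro r hr
        have hr' : x⁻¹ * r * x ∈ R := (hxR _).2 (by simpa [mul_assoc] using hr)
        rw [Subgroup.mem_normalizer_iff_map_conj_eq, Subgroup.map_map]
        have h1 := Subgroup.mem_normalizer_iff_map_conj_eq.1 hr'.2
        conv_rhs => rw [← h1, Subgroup.map_map]
        congr 1
        ext y
        simp [mul_assoc]
      · rintro _ ⟨y, hy, rfl⟩ _ ⟨z, hz, rfl⟩
        rw [← map_mul, hab y hy z hz, map_mul]
    refine ⟨hx, Subgroup.mem_normalizer_iff_map_conj_eq.2 ?_⟩
    refine Subgroup.eq_of_le_of_card_ge hmap ?_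
    rw [Subgroup.card_map_of_injective (MulAut.conj x).injective]
  have hnil : Group.IsNilpotent P := hP.isNilpotent
  have hcond := Group.normalizerCondition_of_isNilpotent (G := P)
  have htop : R.subgroupOf P = ⊤ := by
    by_contra hne
    obtain ⟨x, hx, hxR⟩ := SetLike.exists_of_lt (hcond _ (lt_top_iff_ne_top.2 hne))
    refine hxR (hnorm x x.2 fun y => ?_)
    constructor
    · intro hy
      exact (Subgroup.mem_normalizer_iff.1 hx ⟨y, hy.1⟩).1 hy
    · intro hy
      have hyP : y ∈ P := by
        have := P.mul_mem (P.mul_mem (P.inv_mem x.2) hy.1) x.2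
        simpa [mul_assoc] using this
      exact (Subgroup.mem_normalizer_iff.1 hx ⟨y, hyP⟩).2 hy
  exact (Subgroup.subgroupOf_eq_top.1 htop).trans inf_le_right

/-- Two `p`-subgroups of `G` lie, up to conjugation in `G`, in a common `p`-subgroup. -/
theorem exists_common_pSubgroup {G X Y : Subgroup Γ} (hX : IsPGroup p X) (hY : IsPGroup p Y)
    (hXG : X ≤ G) (hYG : Y ≤ G) :
    ∃ P ≤ G, IsPGroup p P ∧ X ≤ P ∧ ∃ c ∈ G, ∀ y ∈ Y, c * y * c⁻¹ ∈ P := by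
  have hX' : IsPGroup p (X.subgroupOf G) := hX.of_equiv (Subgroup.subgroupOfEquivOfLe hXG).symm
  have hY' : IsPGroup p (Y.subgroupOf G) := hY.of_equiv (Subgroup.subgroupOfEquivOfLe hYG).symm
  obtain ⟨P, hP⟩ := hX'.exists_le_sylow
  obtain ⟨Q, hQ⟩ := hY'.exists_le_sylow
  obtain ⟨c, hc⟩ := MulAction.exists_smul_eq G Q P
  refine ⟨(P : Subgroup G).map G.subtype, ?_, P.2.map _, ?_, c, c.2, ?_⟩
  · rintro _ ⟨x, -, rfl⟩
    exact x.2
  · intro x hx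
    exact ⟨⟨x, hXG hx⟩, hP hx, rfl⟩
  · intro y hy
    have h1 : (⟨y, hYG hy⟩ : G) ∈ Q := hQ hy
    refine ⟨c * ⟨y, hYG hy⟩ * c⁻¹, ?_, rfl⟩
    rw [← hc]
    exact (Sylow.coe_subgroup_smul (g := c) (P := Q)) ▸ ⟨_, h1, rfl⟩

end GroupTheory

/-- A unipotent quadratic additive map of a field that is multiplicative up to a constant is the
identity. -/
theorem eq_id_of_quadratic {F : Type*} [Field F] (h2 : (2 : F) ≠ 0) (α : F →+ F)
    (hmul : ∀ x y, α x * α y = α (x * y) * α 1)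
    (hquad : ∀ x, α (α x) - 2 * α x + x = 0) (x : F) : α x = x := by
  by_contra hx
  have ha : α 1 ≠ 0 := by
    intro h
    have := hquad 1
    simp [h] at this
  set a := α 1 with hadef
  -- By `hquad`, y is fixed by α, so multiplicativity gives α w = a(w + 1) for w = x / y.
  set y := α x - x with hy
  have hy0 : y ≠ 0 := sub_ne_zero.2 hx
  have hαx : α x = x + y := by rw [hy]; ring
  have hαy : α y = y := by
    have := hquad x
    rw [hy, map_sub]
    linear_combination this
  set w := x / y
  have hwx : w * y = x := div_mul_cancel₀ x hy0
  have hαw : α w = a * (w + 1) := by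
    have := hmul w y
    rw [hwx, hαx, hαy] at this
    apply mul_right_cancel₀ hy0
    rw [this, ← hwx]
    ring
  have hα1 (z : F) : a * α (a * z) = α a * α z := by rw [hmul a z, mul_comm]
  -- `hquad` at w minus w times `hquad` at 1 is 2(α a - a) = 0, whence a = 1 and α is multiplicative
  -- with α w = w + 1. Then `hquad` at w² reads (w + 2)² - 2(w + 1)² + w² = 0, that is, 2 = 0.
  have q1 : α a - 2 * a + 1 = 0 := hquad 1
  have q2 := hquad w
  rw [hαw] at q2
  have e1 : α (a * (w + 1)) = α a * (w + 2) := by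
    apply mul_left_cancel₀ ha
    rw [hα1, map_add, hαw]
    ring
  rw [e1] at q2
  have haa : α a = a := by
    apply mul_left_cancel₀ h2
    linear_combination q2 - w * q1
  have ha1 : a = 1 := by linear_combination haa - q1
  have q3 := hquad (w * w)
  have e2 : α (w * w) = (w + 1) * (w + 1) := by
    have := hmul w w
    rw [hαw, ha1] at this
    linear_combination -this
  have e3 : α (w + 1) = w + 2 := by
    rw [map_add, hαw, ← hadef, ha1]; ring
  have e4 : α ((w + 1) * (w + 1)) = (w + 2) * (w + 2) := by
    have := hmul (w + 1) (w + 1)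
    rw [e3, ha1] at this
    linear_combination -this
  rw [e2, e4] at q3
  apply h2
  linear_combination q3

/-! ### Counting in skew Hadamard difference sets -/

section Counting

variable {H : Type*} [AddCommGroup H] [Fintype H]

open Classical in
/-- The group ring equation of a difference set, evaluated on a function `φ`. -/
theorem IsDifferenceSet.sum_sub {v k l : ℕ} {D : Set H} (hD : IsDifferenceSet v k l D)
    (φ : H → ℤ) :
    ∑ a ∈ D.toFinset, ∑ b ∈ D.toFinset, φ (a - b) = ((k : ℤ) - l) * φ 0 + l * ∑ x, φ x := by
  have h := hD.2.2
  let L : AddMonoidAlgebra ℤ H →ₗ[ℤ] ℤ :=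
    Finsupp.linearCombination ℤ φ ∘ₗ (AddMonoidAlgebra.coeffLinearEquiv ℤ).toLinearMap
  have hL : ∀ x (c : ℤ), L (AddMonoidAlgebra.single x c) = c * φ x := fun x c => by
    simp [L]
  have h' := congrArg L h
  simp only [groupRingSum, Finset.sum_mul_sum, map_sum, map_add, map_smul,
    AddMonoidAlgebra.single_mul_single, AddMonoidAlgebra.one_def, hL] at h'
  have e1 : (Set.toFinite (-D)).toFinset = D.toFinset.map (Equiv.neg H).toEmbedding := by
    ext x
    rw [Set.Finite.mem_toFinset, Set.mem_neg, Finset.mem_map_equiv, Set.mem_toFinset]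
    rfl
  have e2 : (Set.toFinite D).toFinset = D.toFinset := by ext x; simp
  have e3 : (Set.toFinite (Set.univ : Set H)).toFinset = Finset.univ := by ext x; simp
  rw [e1, e2, e3] at h'
  simpa only [Finset.sum_map, Equiv.coe_toEmbedding, Equiv.neg_apply, ← sub_eq_add_neg, one_mul,
    smul_eq_mul] using h'

theorem IsSkewHadamardDifferenceSet.zero_notMem {D : Set H}
    (hD : IsSkewHadamardDifferenceSet D) : (0 : H) ∉ D := fun h => by
  have : (0 : H) ∈ D ∪ -D := Or.inl h
  rw [hD.2.1] at this
  exact this rfl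

theorem IsSkewHadamardDifferenceSet.neg_notMem {D : Set H}
    (hD : IsSkewHadamardDifferenceSet D) {x : H} (hx : x ∈ D) : -x ∉ D := fun h => by
  have : x ∈ D ∩ -D := ⟨hx, h⟩
  rw [hD.2.2] at this
  exact this

theorem IsSkewHadamardDifferenceSet.mem_or_neg_mem {D : Set H}
    (hD : IsSkewHadamardDifferenceSet D) {x : H} (hx : x ≠ 0) : x ∈ D ∨ -x ∈ D := by
  have : x ∈ D ∪ -D := by
    rw [hD.2.1]
    exact hx
  exact this

theorem IsSkewHadamardDifferenceSet.neg_mem_iff {D : Set H}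
    (hD : IsSkewHadamardDifferenceSet D) {x : H} (hx : x ≠ 0) : -x ∈ D ↔ x ∉ D :=
  ⟨fun h h' => hD.neg_notMem h' h, (hD.mem_or_neg_mem hx).resolve_left⟩

open Classical in
theorem IsSkewHadamardDifferenceSet.two_mul_card_add_one {D : Set H}
    (hD : IsSkewHadamardDifferenceSet D) :
    2 * (D.toFinset.card : ℤ) + 1 = Fintype.card H := by
  have h1 : (D.toFinset.map (Equiv.neg H).toEmbedding) = (insert 0 D.toFinset)ᶜ := by
    ext x
    rw [Finset.mem_map_equiv, Finset.mem_compl, Finset.mem_insert, Set.mem_toFinset,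
      Set.mem_toFinset, not_or]
    change -x ∈ D ↔ _
    by_cases hx : x = 0
    · simp [hx, hD.zero_notMem]
    · simp [hx, hD.neg_mem_iff hx]
  have h2 := congrArg Finset.card h1
  rw [Finset.card_map] at h2
  have h3 := Finset.card_compl_add_card (insert 0 D.toFinset)
  rw [← h2, Finset.card_insert_of_notMem (by simpa using hD.zero_notMem)] at h3
  omega

open Classical in
/-- The group ring equation of a skew Hadamard difference set, with its parameters determined. -/
theorem IsSkewHadamardDifferenceSet.sum_sub {D : Set H}
    (hD : IsSkewHadamardDifferenceSet D) (hH : 1 < Fintype.card H) (φ : H → ℤ) :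
    4 * ∑ a ∈ D.toFinset, ∑ b ∈ D.toFinset, φ (a - b) =
      ((Fintype.card H : ℤ) + 1) * φ 0 + ((Fintype.card H : ℤ) - 3) * ∑ x, φ x := by
  obtain ⟨v, k, l, h⟩ := hD.1
  have hk : k = D.toFinset.card := by rw [h.2.1, Set.ncard_eq_toFinset_card']
  have hv := hD.two_mul_card_add_one
  -- The constant function gives k² = k - l + l v; with v = 2k + 1 this is l = (k - 1) / 2.
  have h1 := h.sum_sub (fun _ => 1)
  simp only [Finset.sum_const, nsmul_eq_mul, mul_one, Finset.card_univ, ← hk] at h1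
  rw [← hk] at hv
  have hk0 : (k : ℤ) ≠ 0 := by
    intro h0
    rw [h0] at hv
    have : (1 : ℤ) < Fintype.card H := by exact_mod_cast hH
    omega
  have hl : 2 * (l : ℤ) = k - 1 := by
    apply mul_left_cancel₀ hk0
    rw [← hv] at h1
    linear_combination -h1
  rw [h.sum_sub φ, ← hv]
  linear_combination (2 * ∑ x, φ x - 2 * φ 0) * hl

/-- A skew Hadamard difference set is not almost invariant under a translation. -/
theorem IsSkewHadamardDifferenceSet.not_translate_subset {D : Set H}
    (hD : IsSkewHadamardDifferenceSet D) (hH : 3 < Fintype.card H) {c : H} (hc : c ≠ 0)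
    (h : ∀ x ∈ D, x + c ∈ D ∨ x + c = 0) : False := by
  classical
  -- The indicator of c counts the pairs with a - b = c: there are (k - 1) / 2 of them, whereas `h`
  -- supplies one for each b in D other than -c, so at least k - 1.
  have h1 := hD.sum_sub (by omega) (fun x => if x = c then 1 else 0)
  rw [Finset.sum_comm, if_neg hc.symm, Finset.sum_ite_eq' Finset.univ c,
    if_pos (Finset.mem_univ _)] at h1
  have h2 : ∀ b ∈ D.toFinset, (1 : ℤ) - (if b = -c then 1 else 0) ≤
      ∑ a ∈ D.toFinset, if a - b = c then 1 else 0 := by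
    intro b hb
    simp only [sub_eq_iff_eq_add']
    rw [Finset.sum_ite_eq' D.toFinset (b + c)]
    rcases h b (Set.mem_toFinset.1 hb) with h' | h'
    · rw [if_pos (Set.mem_toFinset.2 h')]
      split_ifs <;> simp
    · rw [if_pos (eq_neg_of_add_eq_zero_left h')]
      split_ifs <;> simp
  have h3 := Finset.sum_le_sum h2
  rw [Finset.sum_sub_distrib, Finset.sum_ite_eq' D.toFinset (-c)] at h3
  have h4 : (if -c ∈ D.toFinset then (1 : ℤ) else 0) ≤ 1 := by split_ifs <;> simp
  simp only [Finset.sum_const, nsmul_eq_mul, mul_one] at h3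
  have hv := hD.two_mul_card_add_one
  have hH' : (3 : ℤ) < Fintype.card H := by exact_mod_cast hH
  linarith

/-- An additive bijection mapping `D` onto a translate of `D'` maps `D` onto `D'`. -/
theorem IsSkewHadamardDifferenceSet.translate_eq_zero {D D' : Set H}
    (hD : IsSkewHadamardDifferenceSet D) (hD' : IsSkewHadamardDifferenceSet D')
    (hH : 3 < Fintype.card H) (h2 : ∀ x : H, x + x = 0 → x = 0) (u : H ≃ H)
    (hu : ∀ x y, u (x + y) = u x + u y) {h : H} (hh : u '' D = (fun x => x + h) '' D') :
    h = 0 := by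
  have hu0 : u 0 = 0 := by simpa using hu 0 0
  have hun : ∀ x, u (-x) = - u x := fun x => by
    rw [eq_neg_iff_add_eq_zero, ← hu, neg_add_cancel, hu0]
  have hmem : ∀ x, u x ∈ (fun y => y + h) '' D' ↔ x ∈ D := fun x => by
    rw [← hh, u.injective.mem_set_image]
  have hmem' : ∀ x, u x - h ∈ D' ↔ x ∈ D := fun x => by
    rw [← hmem]
    constructor
    · intro hx
      exact ⟨_, hx, sub_add_cancel _ _⟩
    · rintro ⟨y, hy, hyx⟩
      rw [← hyx]
      simpa using hy
  by_contra hne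
  -- D' turns out almost invariant under 2h: if x is in D' but x + 2h is neither in D' nor 0, then
  -- -(x + 2h) is in D', and the preimage y of x + h has both y and -y in D.
  refine hD'.not_translate_subset hH (c := h + h) (fun h0 => hne (h2 h h0)) fun x hx => ?_
  by_contra hcon
  rw [not_or] at hcon
  have h3 := (hD'.mem_or_neg_mem hcon.2).resolve_left hcon.1
  obtain ⟨y, hy⟩ := u.surjective (x + h)
  have h4 : y ∈ D := (hmem' y).1 (by simpa [hy] using hx)
  have h5 : -y ∈ D := (hmem' (-y)).1 (by
    rw [hun, hy]
    convert h3 using 1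
    abel)
  exact hD.neg_notMem h4 h5

end Counting

/-! ### Intersections of D with the planes of fixed third coordinate -/

section Planes

variable {F : Type*} [Field F]

/-- The action of the matrix `E(t)` on column vectors. -/
def eAct (t : F) (v : V F) : V F :=
  ![v 0 + t * v 1 + t ^ 2 / 2 * v 2, v 1 + t * v 2, v 2]

@[simp] theorem eAct_zero_coord (t : F) (v : V F) :
    eAct t v 0 = v 0 + t * v 1 + t ^ 2 / 2 * v 2 := rfl

@[simp] theorem eAct_one_coord (t : F) (v : V F) : eAct t v 1 = v 1 + t * v 2 := rfl

@[simp] theorem eAct_two_coord (t : F) (v : V F) : eAct t v 2 = v 2 := rfl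

theorem V.ext {F : Type*} {v w : V F} (h0 : v 0 = w 0) (h1 : v 1 = w 1) (h2 : v 2 = w 2) : v = w := by
  funext i
  fin_cases i
  · exact h0
  · exact h1
  · exact h2

theorem eAct_add (h2 : (2 : F) ≠ 0) (s t : F) (v : V F) :
    eAct (s + t) v = eAct s (eAct t v) := by
  apply V.ext <;> simp
  · field_simp
    ring
  · ring

@[simp] theorem eAct_zero (v : V F) : eAct 0 v = v := by
  apply V.ext <;> simp

theorem eAct_add_vec (t : F) (v w : V F) : eAct t (v + w) = eAct t v + eAct t w := by
  apply V.ext <;> simp <;> ring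

/-- Invariance under `A`, in terms of vectors, of a skew Hadamard difference set. -/
structure IsInvariantSHDS [Finite F] (D : Set (V F)) : Prop where
  shds : IsSkewHadamardDifferenceSet D
  eAct_mem : ∀ (t : F), ∀ v ∈ D, eAct t v ∈ D
  sq_smul_mem : ∀ s : F, s ≠ 0 → ∀ v ∈ D, (s * s) • v ∈ D

/-- In characteristic `p`, a finite set invariant under a nontrivial translation has order
divisible by `p`. -/
theorem dvd_card_of_add_invariant {p : ℕ} [Fact p.Prime] [CharP F p] (X : Finset F) {c : F}
    (hc : c ≠ 0) (hX : ∀ x ∈ X, x + c ∈ X) : p ∣ X.card := by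
  classical
  let f : Function.End X := fun x => ⟨x + c, hX x x.2⟩
  have hf : ∀ m : ℕ, ∀ x : X, ((f ^ m) x : F) = x + m * c := by
    intro m
    induction m with
    | zero => intro x; rw [Nat.cast_zero, zero_mul, add_zero]; rfl
    | succ m ih =>
      intro x
      rw [pow_succ']
      change (((f ^ m) x : F)) + c = _
      rw [ih]
      push_cast
      ring
  have h1 : f ^ p ^ 1 = 1 := by
    funext x
    apply Subtype.ext
    rw [hf, pow_one, CharP.cast_eq_zero, zero_mul, add_zero]
    rfl
  have h2 := Equiv.Perm.card_fixedPoints_modEq h1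
  have h3 : IsEmpty (Function.fixedPoints f) := ⟨fun x => hc (by
    have := congrArg Subtype.val x.2
    change (x.1 : F) + c = x.1 at this
    simpa using this)⟩
  rw [Fintype.card_coe, Fintype.card_eq_zero] at h2
  exact (Nat.modEq_zero_iff_dvd).1 h2

variable [Fintype F]

theorem two_ne_zero_of_card (hF : Fintype.card F % 4 = 3) : (2 : F) ≠ 0 := by
  have h : ringChar F ≠ 2 := fun h => by
    have := FiniteField.even_card_of_char_two h
    omega
  exact Ring.two_ne_zero h

/-- In a field of order `3` mod `4`, every nonzero element is plus or minus a nonzero square. -/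
theorem exists_sq_or_neg_sq (hF : Fintype.card F % 4 = 3) {a : F} (ha : a ≠ 0) :
    ∃ s : F, s ≠ 0 ∧ (a = s * s ∨ a = -(s * s)) := by
  classical
  have key : IsSquare a ∨ IsSquare (-a) := by
    by_contra! h
    have h1 := quadraticChar_neg_one_iff_not_isSquare.2 h.1
    have h2 := quadraticChar_neg_one_iff_not_isSquare.2 h.2
    have h3 : ¬ IsSquare (-1 : F) := by
      rw [FiniteField.isSquare_neg_one_iff]
      omega
    rw [neg_eq_neg_one_mul, map_mul, h1, quadraticChar_neg_one_iff_not_isSquare.2 h3] at h2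
    norm_num at h2
  rcases key with ⟨s, hs⟩ | ⟨s, hs⟩
  · exact ⟨s, by rintro rfl; simp [ha] at hs, Or.inl hs⟩
  · exact ⟨s, by rintro rfl; simp [ha] at hs, Or.inr (by rw [← hs, neg_neg])⟩

open Classical in
/-- The number of elements of `D` in a plane with fixed third coordinate. -/
noncomputable def planeCard (D : Set (V F)) (z : F) : ℤ := ((D.toFinset.filter fun v => v 2 = z).card : ℤ)

open Classical in
theorem card_plane {F : Type*} [Fintype F] (z : F) :
    ((Finset.univ.filter fun v : V F => v 2 = z).card : ℤ) = (Fintype.card F : ℤ) ^ 2 := by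
  rw [sq, ← Nat.cast_mul, ← Fintype.card_prod, ← Finset.card_univ]
  congr 1
  refine Finset.card_nbij' (fun v => (v 0, v 1)) (fun w => ![w.1, w.2, z]) ?_ ?_ ?_ ?_
  · intro v _
    simp
  · intro w _
    simp
  · intro v hv
    have : v 2 = z := by simpa using hv
    exact V.ext rfl rfl this.symm
  · intro w _
    rfl

/-- Every nonzero z is plus or minus a square multiple of a fixed z₀, so together with
`planeCard_add_neg` this leaves one unknown cardinality off the origin. -/
theorem IsInvariantSHDS.planeCard_sq_mul {D : Set (V F)} (hD : IsInvariantSHDS D) {s : F}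
    (hs : s ≠ 0) (z : F) : planeCard D (s * s * z) = planeCard D z := by
  classical
  unfold planeCard
  congr 1
  symm
  refine Finset.card_nbij' (fun v => (s * s) • v) (fun v => (s⁻¹ * s⁻¹) • v) ?_ ?_ ?_ ?_
  · intro v hv
    simp only [Finset.coe_filter, Set.mem_toFinset, Set.mem_ofPred_eq, Pi.smul_apply,
      smul_eq_mul] at hv ⊢
    exact ⟨hD.sq_smul_mem s hs v hv.1, by rw [hv.2]⟩
  · intro v hv
    simp only [Finset.coe_filter, Set.mem_toFinset, Set.mem_ofPred_eq, Pi.smul_apply,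
      smul_eq_mul] at hv ⊢
    refine ⟨hD.sq_smul_mem _ (inv_ne_zero hs) v hv.1, ?_⟩
    rw [hv.2]
    field_simp
  · intro v _
    simp only [smul_smul]
    convert one_smul F v using 2
    field_simp
  · intro v _
    simp only [smul_smul]
    convert one_smul F v using 2
    field_simp

-- Negation exchanges D with the nonzero vectors outside D. The inserted 0 matters only for z = 0.
open Classical in
theorem planeCard_neg_eq {D : Set (V F)} (hD : IsSkewHadamardDifferenceSet D) (z : F) :
    planeCard D (-z) =
      (((Finset.univ.filter fun v : V F => v 2 = z) \
        (insert 0 (D.toFinset.filter fun v => v 2 = z))).card : ℤ) := by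
  unfold planeCard
  congr 1
  refine Finset.card_nbij' (fun v => -v) (fun v => -v) ?_ ?_ ?_ ?_
  · intro v hv
    simp only [Finset.coe_filter, Set.mem_toFinset, Set.mem_ofPred_eq, Finset.coe_sdiff,
      Finset.mem_univ, true_and, Set.mem_sdiff, Pi.neg_apply, Finset.coe_insert,
      Set.mem_insert_iff, not_or, not_and, neg_eq_zero] at hv ⊢
    refine ⟨by rw [hv.2, neg_neg], ?_, fun h => absurd h (hD.neg_notMem hv.1)⟩
    rintro rfl
    exact hD.zero_notMem hv.1
  · intro v hv
    simp only [Finset.coe_filter, Set.mem_toFinset, Set.mem_ofPred_eq, Finset.coe_sdiff,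
      Finset.mem_univ, true_and, Set.mem_sdiff, Pi.neg_apply, Finset.coe_insert,
      Set.mem_insert_iff, not_or, not_and] at hv ⊢
    exact ⟨(hD.neg_mem_iff hv.2.1).2 fun h => hv.2.2 h hv.1, by rw [hv.1]⟩
  · intro v _
    simp
  · intro v _
    simp

theorem planeCard_add_neg {D : Set (V F)} (hD : IsSkewHadamardDifferenceSet D) {z : F}
    (hz : z ≠ 0) : planeCard D (-z) = (Fintype.card F : ℤ) ^ 2 - planeCard D z := by
  classical
  rw [planeCard_neg_eq hD, ← card_plane z, planeCard]
  have h1 : (Finset.univ.filter fun v : V F => v 2 = z) \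
      (insert 0 (D.toFinset.filter fun v => v 2 = z)) =
      (Finset.univ.filter fun v : V F => v 2 = z) \ (D.toFinset.filter fun v => v 2 = z) := by
    ext v
    simp only [Finset.mem_sdiff, Finset.mem_insert, not_or, Finset.mem_filter, Finset.mem_univ,
      true_and]
    refine ⟨fun h => ⟨h.1, h.2.2⟩, fun h => ⟨h.1, ?_, h.2⟩⟩
    rintro rfl
    exact hz h.1.symm
  rw [h1, Finset.cast_card_sdiff]
  exact Finset.filter_subset_filter _ (Finset.subset_univ _)

theorem two_mul_planeCard_zero {D : Set (V F)} (hD : IsSkewHadamardDifferenceSet D) :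
    2 * planeCard D 0 + 1 = (Fintype.card F : ℤ) ^ 2 := by
  classical
  have h := planeCard_neg_eq hD 0
  rw [neg_zero, Finset.cast_card_sdiff, card_plane, Finset.card_insert_of_notMem] at h
  · rw [planeCard] at h ⊢
    push_cast at h
    linarith
  · simp [hD.zero_notMem]
  · intro v hv
    rcases Finset.mem_insert.1 hv with rfl | hv
    · simp
    · simpa using (Finset.mem_filter.1 hv).2

-- This evaluates the group ring equation on the indicator of the subgroup of vectors with third
-- coordinate 0.
open Classical in
theorem sum_planeCard_sq (D : Set (V F)) :
    ∑ a ∈ D.toFinset, ∑ b ∈ D.toFinset, (if (a - b) 2 = 0 then (1 : ℤ) else 0) =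
      ∑ z, planeCard D z ^ 2 := by
  have h1 : ∀ a ∈ D.toFinset, ∑ b ∈ D.toFinset, (if (a - b) 2 = 0 then (1 : ℤ) else 0) =
      planeCard D (a 2) := by
    intro a _
    rw [planeCard, Finset.card_filter]
    push_cast
    refine Finset.sum_congr rfl fun b _ => ?_
    exact if_congr (by rw [Pi.sub_apply, sub_eq_zero, eq_comm]) rfl rfl
  rw [Finset.sum_congr rfl h1, ← Finset.sum_fiberwise D.toFinset (fun a => a 2)]
  refine Finset.sum_congr rfl fun z _ => ?_
  rw [Finset.sum_congr rfl (g := fun _ => planeCard D z) fun a ha => by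
    rw [(Finset.mem_filter.1 ha).2]]
  rw [Finset.sum_const, nsmul_eq_mul, sq]
  rfl

/-- The number of elements of an invariant difference set in a plane off the origin satisfies a
quadratic equation. -/
theorem IsInvariantSHDS.planeCard_eq (hF : Fintype.card F % 4 = 3) {D : Set (V F)}
    (hD : IsInvariantSHDS D) {z₀ : F} (hz₀ : z₀ ≠ 0) :
    2 * (planeCard D z₀ ^ 2 + ((Fintype.card F : ℤ) ^ 2 - planeCard D z₀) ^ 2) =
      (Fintype.card F : ℤ) ^ 2 * ((Fintype.card F : ℤ) ^ 2 + 1) := by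
  classical
  set q : ℤ := (Fintype.card F : ℤ) with hq
  have hq1 : 1 < q := by
    rw [hq]
    exact_mod_cast Fintype.one_lt_card (α := F)
  set n := planeCard D z₀ with hn
  have hcard : (Fintype.card (V F) : ℤ) = q ^ 3 := by
    rw [Fintype.card_fun, Fintype.card_fin]
    push_cast
    rfl
  have hV : 1 < Fintype.card (V F) := Fintype.one_lt_card
  have h1 := hD.shds.sum_sub hV (fun v => if v 2 = 0 then 1 else 0)
  rw [sum_planeCard_sq, hcard, Finset.sum_boole, card_plane, ← hq, if_pos (Pi.zero_apply _)] at h1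
  have hpair : ∀ z ∈ Finset.univ.erase (0 : F),
      planeCard D z ^ 2 + planeCard D (-z) ^ 2 = n ^ 2 + (q ^ 2 - n) ^ 2 := by
    intro z hz
    have hz0 : z ≠ 0 := Finset.ne_of_mem_erase hz
    obtain ⟨s, hs, h⟩ := exists_sq_or_neg_sq hF (div_ne_zero hz0 hz₀)
    rw [planeCard_add_neg hD.shds hz0, ← hq]
    rcases h with h | h
    · rw [div_eq_iff hz₀] at h
      rw [h, hD.planeCard_sq_mul hs]
    · rw [div_eq_iff hz₀] at h
      rw [h, neg_mul, ← mul_neg, hD.planeCard_sq_mul hs, planeCard_add_neg hD.shds hz₀, ← hq,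
        ← hn]
      ring
  have h2 := Finset.sum_congr rfl hpair
  have hneg : ∑ z ∈ Finset.univ.erase (0 : F), planeCard D (-z) ^ 2 =
      ∑ z ∈ Finset.univ.erase (0 : F), planeCard D z ^ 2 :=
    Finset.sum_nbij' (fun z => -z) (fun z => -z) (by simp) (by simp) (by simp) (by simp)
      (by simp)
  rw [Finset.sum_add_distrib, hneg, Finset.sum_const, nsmul_eq_mul,
    Finset.cast_card_erase_of_mem (Finset.mem_univ _), Finset.card_univ, ← hq] at h2
  have h3 := Finset.add_sum_erase Finset.univ (fun z => planeCard D z ^ 2) (Finset.mem_univ (0 : F))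
  have h4 := two_mul_planeCard_zero hD.shds
  rw [← hq] at h4
  rw [← h3] at h1
  -- All q - 1 nonzero z contribute the same amount to `h2`, so this factor cancels.
  have hq1' : q - 1 ≠ 0 := by omega
  apply mul_left_cancel₀ hq1'
  linear_combination -2 * h2 + h1 - h4 * (2 * planeCard D 0 - 1 + q ^ 2)

/-- No nontrivial transvection `(x, y, z) ↦ (x + c(z), y, z)` preserves an invariant difference
set. -/
theorem IsInvariantSHDS.shear_eq_zero {p : ℕ} [Fact p.Prime] [CharP F p]
    (hF : Fintype.card F % 4 = 3) {D : Set (V F)}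
    (hD : IsInvariantSHDS D) {c : F → F} (hc0 : c 0 = 0)
    (hc : ∀ v ∈ D, ![v 0 + c (v 2), v 1, v 2] ∈ D) (z : F) : c z = 0 := by
  classical
  by_contra hcz
  have hz : z ≠ 0 := by
    rintro rfl
    exact hcz hc0
  have h2 : (2 : F) ≠ 0 := two_ne_zero_of_card hF
  -- X is the slice y = 0 of D in the plane. It has the period c(z), so p divides |X|; and E moves
  -- the slice simply transitively onto all values of y, so the plane contains q|X| elements of D.
  let X : Finset F := Finset.univ.filter fun x => ![x, 0, z] ∈ D
  have hX : p ∣ X.card := dvd_card_of_add_invariant X hcz fun x hx => by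
    have := hc _ (Finset.mem_filter.1 hx).2
    simpa [X] using this
  have hcard : planeCard D z = X.card * Fintype.card F := by
    rw [planeCard, ← Nat.cast_mul, ← Finset.card_univ, ← Finset.card_product]
    congr 1
    symm
    refine Finset.card_nbij' (fun w => eAct w.2 ![w.1, 0, z])
      (fun v => (eAct (-(v 1 / z)) v 0, v 1 / z)) ?_ ?_ ?_ ?_
    · rintro ⟨x, t⟩ hx
      simp only [Finset.coe_product, Set.mem_prod, Finset.coe_univ, Set.mem_univ, and_true,
        Finset.coe_filter, Set.mem_toFinset, Set.mem_ofPred_eq, X, Finset.mem_univ, true_and] at hx ⊢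
      exact ⟨hD.eAct_mem _ _ hx, rfl⟩
    · intro v hv
      simp only [Finset.coe_product, Set.mem_prod, Finset.coe_univ, Set.mem_univ, and_true,
        Finset.coe_filter, Set.mem_toFinset, Set.mem_ofPred_eq, X, Finset.mem_univ, true_and] at hv ⊢
      convert hD.eAct_mem (-(v 1 / z)) v hv.1 using 1
      apply V.ext
      · rfl
      · simp only [eAct_one_coord, hv.2]
        simp [hz]
      · exact hv.2.symm
    · rintro ⟨x, t⟩ _
      have ht : (eAct t ![x, 0, z] 1) / z = t := by simp [hz]
      simp only [ht]
      rw [← eAct_add h2]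
      simp
    · intro v hv
      simp only [Finset.coe_filter, Set.mem_toFinset, Set.mem_ofPred_eq] at hv
      have : ![eAct (-(v 1 / z)) v 0, 0, z] = eAct (-(v 1 / z)) v := by
        apply V.ext
        · rfl
        · simp only [eAct_one_coord, hv.2]
          simp [hz]
        · exact hv.2.symm
      simp only [this]
      rw [← eAct_add h2]
      simp
  have hmain := hD.planeCard_eq hF hz
  have hpq : (p : ℤ) ∣ Fintype.card F := by
    have : p ∣ Fintype.card F := by
      rw [← CharP.cast_eq_zero_iff F p, Nat.cast_card_eq_zero]
    exact_mod_cast this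
  obtain ⟨m, hm⟩ := hX
  obtain ⟨r, hr⟩ := hpq
  have hq0 : (Fintype.card F : ℤ) ^ 2 ≠ 0 := by
    have := Fintype.card_ne_zero (α := F)
    positivity
  rw [hcard, hm] at hmain
  -- After division by q², every term but the final 1 is divisible by p.
  have h3 : 2 * ((p * m) ^ 2 + ((Fintype.card F : ℤ) - p * m) ^ 2) =
      (Fintype.card F : ℤ) ^ 2 + 1 := by
    apply mul_left_cancel₀ hq0
    rw [← hmain]
    push_cast
    ring
  have h4 : (p : ℤ) ∣ 1 := by
    rw [hr] at h3
    refine ⟨2 * (p * m ^ 2 + p * (r - m) ^ 2) - p * r ^ 2, ?_⟩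
    linear_combination -h3
  have h5 : p ∣ 1 := by exact_mod_cast h4
  exact (Fact.out : p.Prime).one_lt.ne' (Nat.dvd_one.1 h5)

end Planes

/-! ### The centralizer of E -/

section Centralizer

variable {F : Type*} [Field F]

theorem eAct_sub_self (t : F) (v : V F) :
    eAct t v = v + ![t * v 1 + t ^ 2 / 2 * v 2, t * v 2, 0] := by
  apply V.ext <;> simp [add_assoc]

/-- The additive maps commuting with all `E(t)`. -/
theorem exists_form_of_commute_eAct (h2 : (2 : F) ≠ 0) (u : V F → V F)
    (hadd : ∀ v w, u (v + w) = u v + u w) (hE : ∀ t v, u (eAct t v) = eAct t (u v)) :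
    ∃ (a b : F) (c : F → F), c 0 = 0 ∧
      ∀ v, u v = ![a * v 0 + b * v 1 + c (v 2), a * v 1 + b * v 2, a * v 2] := by
  have hu0 : u 0 = 0 := by simpa using hadd 0 0
  have key : ∀ t v, u ![t * v 1 + t ^ 2 / 2 * v 2, t * v 2, 0] =
      ![t * u v 1 + t ^ 2 / 2 * u v 2, t * u v 2, 0] := by
    intro t v
    have := hE t v
    rw [eAct_sub_self, eAct_sub_self, hadd] at this
    exact add_left_cancel this
  have hx : ∀ t y, u ![t * y, 0, 0] =
      ![t * u ![0, y, 0] 1 + t ^ 2 / 2 * u ![0, y, 0] 2, t * u ![0, y, 0] 2, 0] := by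
    intro t y
    simpa using key t ![0, y, 0]
  set a := u ![0, 1, 0] 1 with ha
  -- By `hx`, the first coordinate of u(t, 0, 0) has a term quadratic in t; additivity, compared at
  -- t = 1 and t = 2, kills it.
  have hw3 : u ![0, 1, 0] 2 = 0 := by
    have h1 := congrFun (hx 1 1) 0
    have h2' := congrFun (hx 2 1) 0
    have h3 : u ![2 * 1, 0, 0] = u ![1 * 1, 0, 0] + u ![1 * 1, 0, 0] := by
      rw [← hadd]
      congr 1
      apply V.ext <;> simp
      norm_num
    rw [h3, Pi.add_apply, h1] at h2'
    simp only [Matrix.cons_val_zero] at h2'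
    field_simp at h2'
    have h4 : (2 : F) * u ![0, 1, 0] 2 = 0 := by linear_combination -h2'
    exact (mul_eq_zero.1 h4).resolve_left h2
  have hu1 : ∀ t, u ![t, 0, 0] = ![a * t, 0, 0] := by
    intro t
    have := hx t 1
    rw [hw3, mul_one] at this
    rw [this]
    apply V.ext <;> simp [ha, mul_comm]
  have hy : ∀ y, u ![0, y, 0] = ![u ![0, y, 0] 0, a * y, 0] := by
    intro y
    have := hx 1 y
    rw [hu1] at this
    have h1 := congrFun this 1
    have h0 := congrFun this 0
    simp only [Matrix.cons_val_one, Matrix.cons_val_zero, one_mul] at h0 h1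
    rw [← h1] at h0
    apply V.ext
    · rfl
    · simp [h0]
    · simp [← h1]
  have hz : ∀ t z, u ![t ^ 2 / 2 * z, t * z, 0] =
      ![t * u ![0, 0, z] 1 + t ^ 2 / 2 * u ![0, 0, z] 2, t * u ![0, 0, z] 2, 0] := by
    intro t z
    simpa using key t ![0, 0, z]
  have hz' : ∀ t z, u ![t ^ 2 / 2 * z, t * z, 0] =
      ![a * (t ^ 2 / 2 * z) + u ![0, t * z, 0] 0, a * (t * z), 0] := by
    intro t z
    have : (![t ^ 2 / 2 * z, t * z, 0] : V F) = ![t ^ 2 / 2 * z, 0, 0] + ![0, t * z, 0] := by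
      apply V.ext <;> simp
    rw [this, hadd, hu1, hy]
    apply V.ext <;> simp
  have hz2 : ∀ z, u ![0, 0, z] 2 = a * z := by
    intro z
    have := congrFun ((hz 1 z).symm.trans (hz' 1 z)) 1
    simpa using this
  have hz1 : ∀ t z, u ![0, t * z, 0] 0 = t * u ![0, 0, z] 1 := by
    intro t z
    have := congrFun ((hz t z).symm.trans (hz' t z)) 0
    simp only [Matrix.cons_val_zero, hz2] at this
    linear_combination -this
  set b := u ![0, 0, 1] 1 with hb
  have hy0 : ∀ y, u ![0, y, 0] 0 = b * y := by
    intro y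
    have := hz1 y 1
    rw [mul_one] at this
    rw [this, mul_comm]
  have hz1' : ∀ z, u ![0, 0, z] 1 = b * z := by
    intro z
    have := hz1 1 z
    rw [one_mul, one_mul, hy0] at this
    exact this.symm
  -- Nothing makes c linear over F: a map v ↦ (c(v 2), 0, 0) with c additive commutes with E.
  refine ⟨a, b, fun z => u ![0, 0, z] 0, ?_, fun v => ?_⟩
  · have : (![0, 0, 0] : V F) = 0 := by apply V.ext <;> simp
    simp [this, hu0]
  · have : v = ![v 0, 0, 0] + ![0, v 1, 0] + ![0, 0, v 2] := by apply V.ext <;> simp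
    conv_lhs => rw [this]
    rw [hadd, hadd, hu1, hy, hy0]
    apply V.ext
    · simp
    · simp [hz1']
    · simp [hz2]

variable [Fintype F]

/-- The elements of `Aut(V)` that preserve an invariant difference set and commute with `E` are
those of `A`. -/
theorem IsInvariantSHDS.eq_of_commute_eAct {p : ℕ} [Fact p.Prime] [CharP F p]
    (hF : Fintype.card F % 4 = 3) {D : Set (V F)} (hD : IsInvariantSHDS D) {u : V F → V F}
    (hinj : Function.Injective u) (hadd : ∀ v w, u (v + w) = u v + u w)
    (hE : ∀ t v, u (eAct t v) = eAct t (u v)) (hu : ∀ v ∈ D, u v ∈ D) :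
    ∃ s : F, s ≠ 0 ∧ ∃ t, ∀ v, u v = (s * s) • eAct t v := by
  have h2 : (2 : F) ≠ 0 := two_ne_zero_of_card hF
  obtain ⟨a, b, c, hc0, h⟩ := exists_form_of_commute_eAct h2 u hadd hE
  have ha : a ≠ 0 := by
    intro ha
    have h1 : u ![1, 0, 0] = u 0 := by
      rw [h, h]
      apply V.ext <;> simp [ha]
    simpa using congrFun (hinj h1) 0
  obtain ⟨s, hs, hsa⟩ := exists_sq_or_neg_sq hF ha
  -- If a were minus a square, u followed by a square scalar would negate (x, 0, 0) within D.
  have hsa' : a = s * s := by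
    refine hsa.resolve_right fun hneg => ?_
    have hmove : ∀ x, ![x, 0, 0] ∈ D → ![-x, 0, 0] ∈ D := by
      intro x hx
      have := hD.sq_smul_mem s⁻¹ (inv_ne_zero hs) _ (hu _ hx)
      convert this using 1
      rw [h]
      apply V.ext <;> simp [hc0, hneg]
      field_simp
    have hne : (![1, 0, 0] : V F) ≠ 0 := fun h => by simpa using congrFun h 0
    have hn : -(![1, 0, 0] : V F) = ![-1, 0, 0] := by apply V.ext <;> simp
    rcases hD.shds.mem_or_neg_mem hne with hx | hx
    · refine hD.shds.neg_notMem hx ?_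
      rw [hn]
      exact hmove _ hx
    · refine hD.shds.neg_notMem hx ?_
      rw [neg_neg]
      rw [hn] at hx
      simpa using hmove _ hx
  -- This shear is E(-b/a) a⁻¹ u; the term in (b / a)² / 2 comes from applying E(-b/a).
  have hshear := hD.shear_eq_zero (p := p) hF (c := fun z => c z / a - (b / a) ^ 2 / 2 * z)
    (by simp [hc0]) (fun v hv => by
      have := hD.eAct_mem (-(b / a)) _ (hD.sq_smul_mem s⁻¹ (inv_ne_zero hs) _ (hu _ hv))
      have e : s⁻¹ * s⁻¹ = a⁻¹ := by rw [hsa', mul_inv]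
      convert this using 1
      rw [e, h]
      apply V.ext
      · simp
        field_simp
        ring
      · simp
        field_simp
        ring
      · simp
        field_simp)
  refine ⟨s, hs, b / a, fun v => ?_⟩
  rw [h, ← hsa']
  have h3 := hshear (v 2)
  apply V.ext
  · simp
    field_simp at h3 ⊢
    linear_combination h3
  · simp
    field_simp
  · simp

end Centralizer

/-! ### Conjugates of a largest abelian normal subgroup -/

section GroupTheory

variable {Γ : Type*} [Group Γ] [Finite Γ] {p : ℕ} [Fact p.Prime]

/-- Every abelian normal subgroup of `N_P(H)` is contained in `H`. -/
def ContainsAbelianNormal (P H : Subgroup Γ) : Prop :=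
  ∀ B : Subgroup Γ, B ≤ P ⊓ Subgroup.normalizer (H : Set Γ) →
    (P ⊓ Subgroup.normalizer (H : Set Γ) ≤ Subgroup.normalizer (B : Set Γ)) →
    (∀ x ∈ B, ∀ y ∈ B, x * y = y * x) → B ≤ H

/-- An abelian subgroup that contains the abelian normal subgroups of its normalizer in `P`
coincides with each of its conjugates having the same property. -/
theorem mem_normalizer_of_containsAbelianNormal {P H : Subgroup Γ} (hP : IsPGroup p P)
    (hHP : H ≤ P) (hab : ∀ x ∈ H, ∀ y ∈ H, x * y = y * x) (hmax : ContainsAbelianNormal P H)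
    {g : Γ} (hg : ∀ x ∈ H, g * x * g⁻¹ ∈ P)
    (hmax' : ContainsAbelianNormal (P.comap (MulAut.conj g).toMonoidHom) H) :
    P ≤ Subgroup.normalizer (H : Set Γ) ∧ g ∈ Subgroup.normalizer (H : Set Γ) := by
  have h1 := le_normalizer_of_abelian_normal_le hP hHP hab hmax
  have hP' : IsPGroup p (P.comap (MulAut.conj g).toMonoidHom) :=
    hP.comap_of_injective _ (MulAut.conj g).injective
  have h2 := le_normalizer_of_abelian_normal_le hP' hg hab hmax'
  refine ⟨h1, ?_⟩
  -- H is normal in g⁻¹Pg by `h2`, so gHg⁻¹ is an abelian normal subgroup of P.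
  have hle : H.map (MulAut.conj g).toMonoidHom ≤ H := by
    apply hmax
    · rintro _ ⟨y, hy, rfl⟩
      exact ⟨hg y hy, h1 (hg y hy)⟩
    · intro x hx
      have hx' : g⁻¹ * x * g ∈ Subgroup.normalizer (H : Set Γ) := h2 (by
        change g * (g⁻¹ * x * g) * g⁻¹ ∈ P
        simpa [mul_assoc] using hx.1)
      rw [Subgroup.mem_normalizer_iff_map_conj_eq, Subgroup.map_map]
      have h3 := Subgroup.mem_normalizer_iff_map_conj_eq.1 hx'
      conv_rhs => rw [← h3, Subgroup.map_map]
      congr 1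
      ext y
      simp [mul_assoc]
    · rintro _ ⟨y, hy, rfl⟩ _ ⟨z, hz, rfl⟩
      rw [← map_mul, hab y hy z hz, map_mul]
  rw [Subgroup.mem_normalizer_iff_map_conj_eq]
  refine Subgroup.eq_of_le_of_card_ge hle ?_
  rw [Subgroup.card_map_of_injective (MulAut.conj g).injective]

end GroupTheory

/-! ### Automorphisms of translation designs -/

section Designs

variable {H : Type*}

theorem IsDesignIso.trans {P P' P'' : Type*} {g : P ≃ P'} {g' : P' ≃ P''} {𝓑 : Set (Set P)}
    {𝓑' : Set (Set P')} {𝓑'' : Set (Set P'')} (h : IsDesignIso g 𝓑 𝓑')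
    (h' : IsDesignIso g' 𝓑' 𝓑'') : IsDesignIso (g.trans g') 𝓑 𝓑'' := by
  unfold IsDesignIso at *
  rw [← h', ← h, Set.image_image]
  refine Set.image_congr fun B _ => ?_
  rw [Set.image_image]
  rfl

theorem IsDesignIso.symm {P P' : Type*} {g : P ≃ P'} {𝓑 : Set (Set P)}
    {𝓑' : Set (Set P')} (h : IsDesignIso g 𝓑 𝓑') : IsDesignIso g.symm 𝓑' 𝓑 := by
  unfold IsDesignIso at *
  rw [← h, Set.image_image]
  simp

/-- The automorphism group of a design. -/
def designAut (𝓑 : Set (Set H)) : Subgroup (Equiv.Perm H) where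
  carrier := {g | IsDesignIso g 𝓑 𝓑}
  mul_mem' := fun ha hb => IsDesignIso.trans hb ha
  one_mem' := by
    change _ '' _ = _
    simp
  inv_mem' := fun ha => IsDesignIso.symm ha

variable [AddCommGroup H]

theorem dev_mem (D : Set H) : D ∈ dev D := ⟨0, by simp⟩

/-- An additive permutation mapping `D` onto `D'` is an isomorphism of the translation designs. -/
theorem isDesignIso_of_image_eq {D D' : Set H} {g : Equiv.Perm H}
    (hadd : ∀ v w, g (v + w) = g v + g w) (h : g '' D = D') : IsDesignIso g (dev D) (dev D') := by
  subst h
  apply Set.Subset.antisymm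
  · rintro _ ⟨_, ⟨h, rfl⟩, rfl⟩
    refine ⟨g h, ?_⟩
    simp only [Set.image_image]
    exact Set.image_congr fun x _ => hadd x h
  · rintro _ ⟨h, rfl⟩
    refine ⟨_, ⟨g.symm h, rfl⟩, ?_⟩
    simp only [Set.image_image]
    exact Set.image_congr fun x _ => by rw [hadd, g.apply_symm_apply]

/-- The group of translations of `H`. -/
def translations (H : Type*) [AddCommGroup H] : Subgroup (Equiv.Perm H) where
  carrier := {f | ∃ h, f = Equiv.addRight h}
  mul_mem' := by
    rintro _ _ ⟨h, rfl⟩ ⟨k, rfl⟩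
    exact ⟨k + h, by ext v; simp [add_assoc]⟩
  one_mem' := ⟨0, by ext v; simp⟩
  inv_mem' := by
    rintro _ ⟨h, rfl⟩
    exact ⟨-h, by simp⟩

theorem addRight_mem_translations {H : Type*} [AddCommGroup H] (h : H) :
    Equiv.addRight h ∈ translations H := ⟨h, rfl⟩

theorem translations_comm {H : Type*} [AddCommGroup H] :
    ∀ x ∈ translations H, ∀ y ∈ translations H, x * y = y * x := by
  rintro _ ⟨h, rfl⟩ _ ⟨k, rfl⟩
  ext v
  simp [add_right_comm]

theorem translations_le_designAut (D : Set H) : translations H ≤ designAut (dev D) := by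
  rintro _ ⟨h, rfl⟩
  apply Set.Subset.antisymm
  · rintro _ ⟨_, ⟨k, rfl⟩, rfl⟩
    refine ⟨k + h, ?_⟩
    simp only [Set.image_image]
    exact Set.image_congr fun x _ => add_assoc x k h
  · rintro _ ⟨k, rfl⟩
    refine ⟨_, ⟨k - h, rfl⟩, ?_⟩
    simp only [Set.image_image]
    exact Set.image_congr fun x _ => by simp [add_assoc]

/-- A permutation normalizing the translations and fixing zero is additive. -/
theorem map_add_of_mem_normalizer {H : Type*} [AddCommGroup H] {f : Equiv.Perm H}
    (hf : f ∈ Subgroup.normalizer (translations H : Set (Equiv.Perm H))) (h0 : f 0 = 0) (v w : H) :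
    f (v + w) = f v + f w := by
  obtain ⟨h, hh⟩ := (Subgroup.mem_normalizer_iff.1 hf _).1 (addRight_mem_translations w)
  have h1 : ∀ x, f (x + w) = f x + h := fun x => by
    have := Equiv.congr_fun hh (f x)
    simpa using this
  have h2 := h1 0
  rw [zero_add, h0, zero_add] at h2
  rw [h1, h2]

/-- An additive permutation normalizes the translations. -/
theorem mem_normalizer_translations {H : Type*} [AddCommGroup H] {f : Equiv.Perm H}
    (hf : ∀ v w, f (v + w) = f v + f w) :
    f ∈ Subgroup.normalizer (translations H : Set (Equiv.Perm H)) := by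
  have hf' : ∀ v w, f.symm (v + w) = f.symm v + f.symm w := fun v w => by
    rw [Equiv.symm_apply_eq, hf, f.apply_symm_apply, f.apply_symm_apply]
  rw [Subgroup.mem_normalizer_iff]
  intro x
  constructor
  · rintro ⟨h, rfl⟩
    exact ⟨f h, by ext v; simp [hf]⟩
  · rintro ⟨h, hh⟩
    refine ⟨f.symm h, ?_⟩
    ext v
    have h1 : f (x v) = f v + h := by simpa using Equiv.congr_fun hh (f v)
    rw [Equiv.coe_addRight, ← f.symm_apply_apply (x v), h1, hf', f.symm_apply_apply]

/-- D goes to some block D' + h, and `translate_eq_zero` forces h = 0. -/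
theorem IsSkewHadamardDifferenceSet.image_eq {H : Type*} [AddCommGroup H] [Fintype H]
    {D D' : Set H} (hD : IsSkewHadamardDifferenceSet D) (hD' : IsSkewHadamardDifferenceSet D')
    (hH : 3 < Fintype.card H) (h2 : ∀ x : H, x + x = 0 → x = 0) {u : Equiv.Perm H}
    (hu : ∀ x y, u (x + y) = u x + u y) (hiso : IsDesignIso u (dev D) (dev D')) :
    u '' D = D' := by
  have h1 : u '' D ∈ dev D' := by
    rw [← hiso]
    exact ⟨D, dev_mem D, rfl⟩
  obtain ⟨h, hh⟩ := h1
  have h0 := hD.translate_eq_zero hD' hH h2 u hu hh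
  rw [hh, h0]
  simp

theorem isPGroup_translations {H : Type*} [AddCommGroup H] {p : ℕ}
    (hp : ∀ x : H, p • x = 0) : IsPGroup p (translations H) := by
  rintro ⟨f, hf⟩
  obtain ⟨h, rfl⟩ := hf
  refine ⟨1, Subtype.ext ?_⟩
  rw [SubgroupClass.coe_pow, pow_one]
  simp [hp]

end Designs

/-! ### Abelian normal subgroups lie in T, respectively in E -/

section Unipotent

variable {F : Type*} [Field F]

theorem eAct_injective {s t : F} (h : ∀ v, eAct s v = eAct t v) : s = t := by
  simpa using congrFun (h ![0, 0, 1]) 1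

/-- The product (E(x) - 1)(E(y) - 1) depends only on xy. Hence the action on E of an element of its
normalizer is multiplicative up to a constant. -/
theorem eAct_eAct_sub (x y : F) (v : V F) :
    (eAct x (eAct y v) - eAct y v) - (eAct x v - v) = ![x * y * v 2, 0, 0] := by
  apply V.ext <;> simp
  ring

variable [NeZero (2 : F)]

/-- The permutation of `V` given by `E(t)`. -/
def ePerm (t : F) : Equiv.Perm (V F) where
  toFun := eAct t
  invFun := eAct (-t)
  left_inv v := by rw [← eAct_add two_ne_zero]; simp
  right_inv v := by rw [← eAct_add two_ne_zero]; simp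

@[simp] theorem ePerm_apply (t : F) (v : V F) : ePerm t v = eAct t v := rfl

@[simp] theorem ePerm_inv (t : F) : (ePerm t)⁻¹ = ePerm (-t) := by
  ext1 v
  rfl

theorem ePerm_mul (s t : F) : ePerm s * ePerm t = ePerm (s + t) := by
  ext1 v
  exact (eAct_add two_ne_zero s t v).symm

variable (F) in
/-- The group `E` as a group of permutations of `V`. -/
def eSubgroup : Subgroup (Equiv.Perm (V F)) where
  carrier := {f | ∃ t, f = ePerm t}
  mul_mem' := by
    rintro _ _ ⟨s, rfl⟩ ⟨t, rfl⟩
    exact ⟨s + t, ePerm_mul s t⟩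
  one_mem' := ⟨0, by ext1 v; simp⟩
  inv_mem' := by
    rintro _ ⟨s, rfl⟩
    exact ⟨-s, ePerm_inv s⟩

theorem ePerm_mem (t : F) : ePerm t ∈ eSubgroup F := ⟨t, rfl⟩

theorem eSubgroup_comm : ∀ x ∈ eSubgroup F, ∀ y ∈ eSubgroup F, x * y = y * x := by
  rintro _ ⟨h, rfl⟩ _ ⟨k, rfl⟩
  rw [ePerm_mul, ePerm_mul, add_comm]

theorem isPGroup_eSubgroup {p : ℕ} [CharP F p] : IsPGroup p (eSubgroup F) := by
  rintro ⟨f, hf⟩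
  obtain ⟨t, rfl⟩ := hf
  refine ⟨1, Subtype.ext ?_⟩
  rw [SubgroupClass.coe_pow, pow_one]
  have : ∀ m : ℕ, (ePerm t) ^ m = ePerm (m * t) := by
    intro m
    induction m with
    | zero => ext1 v; simp
    | succ m ih =>
      rw [pow_succ, ih, ePerm_mul]
      push_cast
      ring_nf
  rw [this, CharP.cast_eq_zero, zero_mul]
  ext1 v
  simp

theorem eSubgroup_le_normalizer :
    eSubgroup F ≤ Subgroup.normalizer (translations (V F) : Set (Equiv.Perm (V F))) := by
  rintro _ ⟨t, rfl⟩
  exact mem_normalizer_translations (eAct_add_vec t)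

theorem three_lt_card_V {F : Type*} [Fintype F] (hF : Fintype.card F % 4 = 3) : 3 < Fintype.card (V F) := by
  rw [Fintype.card_fun, Fintype.card_fin]
  have : 3 ≤ Fintype.card F := by omega
  calc 3 < 3 ^ 3 := by norm_num
    _ ≤ _ := Nat.pow_le_pow_left this 3

theorem eq_zero_of_add_self (v : V F) (h : v + v = 0) : v = 0 := by
  funext i
  have := congrFun h i
  rw [Pi.add_apply, ← two_mul] at this
  exact (mul_eq_zero.1 this).resolve_left two_ne_zero

variable [Fintype F] {p : ℕ} [Fact p.Prime] [CharP F p]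

theorem eSubgroup_le_designAut {D : Set (V F)} (hD : IsInvariantSHDS D) :
    eSubgroup F ≤ designAut (dev D) := by
  rintro _ ⟨t, rfl⟩
  refine isDesignIso_of_image_eq (eAct_add_vec t) (Set.Subset.antisymm ?_ ?_)
  · rintro _ ⟨v, hv, rfl⟩
    exact hD.eAct_mem t v hv
  · intro v hv
    exact ⟨eAct (-t) v, hD.eAct_mem _ v hv, by simp [← eAct_add two_ne_zero]⟩

theorem image_eq_of_mem_designAut (hF : Fintype.card F % 4 = 3) {D : Set (V F)}
    (hD : IsInvariantSHDS D) {u : Equiv.Perm (V F)} (hu : ∀ x y, u (x + y) = u x + u y)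
    (h : u ∈ designAut (dev D)) : u '' D = D :=
  hD.shds.image_eq hD.shds (three_lt_card_V hF) eq_zero_of_add_self hu h

/-- The abelian normal subgroups of a `p`-group of design automorphisms normalizing the
translations consist of translations. -/
theorem le_translations_of_abelian_normal (hF : Fintype.card F % 4 = 3) {D : Set (V F)}
    (hD : IsInvariantSHDS D) {R B : Subgroup (Equiv.Perm (V F))} (hR : IsPGroup p R)
    (hRD : R ≤ designAut (dev D))
    (hRT : R ≤ Subgroup.normalizer (translations (V F) : Set (Equiv.Perm (V F))))
    (hT : translations (V F) ≤ R) (hE : eSubgroup F ≤ R) (hBR : B ≤ R)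
    (hB : R ≤ Subgroup.normalizer (B : Set (Equiv.Perm (V F))))
    (hab : ∀ x ∈ B, ∀ y ∈ B, x * y = y * x) : B ≤ translations (V F) := by
  set T := translations (V F)
  let R₀ : Subgroup (Equiv.Perm (V F)) := R ⊓ MulAction.stabilizer (Equiv.Perm (V F)) (0 : V F)
  have hR₀ : ∀ f, f ∈ R₀ ↔ f ∈ R ∧ f 0 = 0 := fun f => Iff.rfl
  -- Each b in B is a translation times an element of B₀, so B ≤ T once B₀ is trivial.
  let B₀ := (B ⊔ T) ⊓ R₀
  by_cases hbot : B₀ = ⊥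
  · intro b hb
    have h1 : Equiv.addRight (-(b 0)) * b ∈ B₀ := by
      refine ⟨mul_mem (Subgroup.mem_sup_right (addRight_mem_translations _))
        (Subgroup.mem_sup_left hb), ?_⟩
      exact ⟨mul_mem (hT (addRight_mem_translations _)) (hBR hb), by simp⟩
    rw [hbot, Subgroup.mem_bot] at h1
    rw [eq_inv_of_mul_eq_one_right h1]
    exact inv_mem (addRight_mem_translations _)
  exfalso
  have hnorm : R₀ ≤ Subgroup.normalizer (B₀ : Set (Equiv.Perm (V F))) := by
    refine le_trans (le_inf ?_ Subgroup.le_normalizer) Subgroup.inf_normalizer_le_normalizer_inf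
    exact le_trans (le_inf (inf_le_left.trans hB) (inf_le_left.trans hRT))
      (Subgroup.normalizer_inf_normalizer_le_normalizer_sup B T)
  obtain ⟨u, hu, hu1, hcomm⟩ := exists_central_of_normalized (hR.to_le inf_le_left) inf_le_right
    hnorm hbot
  have huR : u ∈ R := hu.2.1
  have hu0 : u 0 = 0 := hu.2.2
  have hadd := map_add_of_mem_normalizer (hRT huR) hu0
  have himage := image_eq_of_mem_designAut hF hD hadd (hRD huR)
  have hE0 : ∀ t : F, ePerm t ∈ R₀ := fun t => by
    rw [hR₀]
    refine ⟨hE (ePerm_mem t), ?_⟩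
    apply V.ext <;> simp
  obtain ⟨s, hs, t, h⟩ := hD.eq_of_commute_eAct (p := p) hF u.injective hadd
    (fun t v => (Equiv.congr_fun (hcomm _ (hE0 t)) v).symm)
    (fun v hv => himage ▸ Set.mem_image_of_mem u hv)
  -- Write u = bτ with b in B and τ in T. The commutator of u with translation by w is translation
  -- by u w - w; it equals that of b, so it lies in B and commutes with both b and τ. Thus (u - 1)²
  -- = 0.
  have hquad : ∀ w, u (u w - w) = u w - w := by
    intro w
    have hu' : u ∈ ((B ⊔ T : Subgroup (Equiv.Perm (V F))) : Set (Equiv.Perm (V F))) := hu.1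
    rw [Subgroup.coe_mul_of_left_le_normalizer_right B T (hBR.trans hRT)] at hu'
    obtain ⟨b, hb, τ, hτ, hbτ⟩ := hu'
    have h1 : u * Equiv.addRight w * u⁻¹ * (Equiv.addRight w)⁻¹ = Equiv.addRight (u w - w) := by
      rw [mul_inv_eq_iff_eq_mul, mul_inv_eq_iff_eq_mul]
      ext1 v
      simp only [Equiv.Perm.mul_apply, Equiv.coe_addRight, hadd]
      abel
    have h2 : u * Equiv.addRight w * u⁻¹ * (Equiv.addRight w)⁻¹ =
        b * (Equiv.addRight w * b⁻¹ * (Equiv.addRight w)⁻¹) := by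
      have : τ * Equiv.addRight w * τ⁻¹ = Equiv.addRight w :=
        mul_inv_eq_iff_eq_mul.2 (translations_comm _ hτ _ (addRight_mem_translations w))
      rw [← hbτ]
      calc _ = b * (τ * Equiv.addRight w * τ⁻¹) * b⁻¹ * (Equiv.addRight w)⁻¹ := by
            simp only [mul_assoc, mul_inv_rev]
        _ = _ := by rw [this]; simp only [mul_assoc]
    have h3 : Equiv.addRight (u w - w) ∈ B := by
      rw [← h1, h2]
      exact mul_mem hb ((Subgroup.mem_normalizer_iff.1
        (hB (hT (addRight_mem_translations w))) _).1 (inv_mem hb))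
    have h4 : u * Equiv.addRight (u w - w) = Equiv.addRight (u w - w) * u := by
      have hbτ' : u = b * τ := hbτ.symm
      generalize u w - w = x at h3
      rw [hbτ', mul_assoc, translations_comm _ hτ _ (addRight_mem_translations x),
        ← mul_assoc, hab _ hb _ h3, mul_assoc]
    have h5 := Equiv.congr_fun h4 0
    simpa [hu0] using h5
  -- For u = s²E(t) the third coordinate yields (s² - 1)² = 0, and then the first yields t² = 0.
  have hq := hquad ![0, 0, 1]
  rw [h (_ - _), h] at hq
  have hq2 : s * s * (s * s * 1 - 1) = s * s * 1 - 1 := congrFun hq 2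
  have hss : s * s = 1 := by
    have : (s * s - 1) ^ 2 = 0 := by linear_combination hq2
    exact sub_eq_zero.1 (pow_eq_zero_iff two_ne_zero |>.1 this)
  rw [hss, one_smul, one_smul] at hq
  have hq0 : (0 + t * 0 + t ^ 2 / 2 * 1 - 0) + t * (0 + t * 1 - 0) + t ^ 2 / 2 * (1 - 1) =
    0 + t * 0 + t ^ 2 / 2 * 1 - 0 := congrFun hq 0
  have ht : t = 0 := by
    have : t ^ 2 = 0 := by linear_combination hq0
    exact pow_eq_zero_iff two_ne_zero |>.1 this
  apply hu1
  ext1 v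
  rw [h, hss, ht]
  simp

/-- The abelian normal subgroups of a `p`-group of automorphisms of `V` that preserves an
invariant difference set and normalizes `E` are contained in `E`. -/
theorem le_eSubgroup_of_abelian_normal (hF : Fintype.card F % 4 = 3) {D : Set (V F)}
    (hD : IsInvariantSHDS D) {R B : Subgroup (Equiv.Perm (V F))} (hR : IsPGroup p R)
    (hRadd : ∀ f ∈ R, ∀ v w, f (v + w) = f v + f w) (hRD : ∀ f ∈ R, ∀ v ∈ D, f v ∈ D)
    (hRE : R ≤ Subgroup.normalizer (eSubgroup F : Set (Equiv.Perm (V F))))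
    (hE : eSubgroup F ≤ R) (hBR : B ≤ R)
    (hB : R ≤ Subgroup.normalizer (B : Set (Equiv.Perm (V F))))
    (hab : ∀ x ∈ B, ∀ y ∈ B, x * y = y * x) : B ≤ eSubgroup F := by
  intro u hu
  have huR := hBR hu
  have hadd := hRadd u huR
  have hα : ∀ t, ∃ t', u * ePerm t * u⁻¹ = ePerm t' := fun t =>
    (Subgroup.mem_normalizer_iff.1 (hRE huR) _).1 (ePerm_mem t)
  choose α hα using hα
  have hα' : ∀ t v, u (eAct t v) = eAct (α t) (u v) := fun t v => by
    have := Equiv.congr_fun (mul_inv_eq_iff_eq_mul.1 (hα t)) v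
    exact this
  have hαadd : ∀ s t, α (s + t) = α s + α t := by
    intro s t
    apply eAct_injective
    intro v
    obtain ⟨w, rfl⟩ := u.surjective v
    rw [← hα', eAct_add two_ne_zero, hα', hα', eAct_add two_ne_zero]
  let U : V F →+ V F := AddMonoidHom.mk' u hadd
  have hU : ∀ v, U v = u v := fun v => rfl
  -- With u v₀ = (0, 0, 1), the first coordinate of (E(α x) - 1)(E(α y) - 1) u v₀ is exactly α x α
  -- y.
  obtain ⟨v₀, hv₀⟩ := u.surjective ![0, 0, 1]
  have hprod : ∀ x y, α x * α y = u ![x * y * v₀ 2, 0, 0] 0 := by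
    intro x y
    rw [← eAct_eAct_sub x y v₀, ← hU]
    rw [map_sub, map_sub, map_sub]
    simp only [hU, hα']
    rw [eAct_eAct_sub, hv₀]
    simp
  have hmul : ∀ x y, α x * α y = α (x * y) * α 1 := by
    intro x y
    rw [hprod, hprod, mul_one]
  -- The commutator of u and E(t) is E(α t - t); it lies in the abelian group B with u, so α fixes α
  -- t - t.
  have hquad : ∀ t, α (α t) - 2 * α t + t = 0 := by
    intro t
    have h1 : ePerm (α t - t) ∈ B := by
      have : ePerm (α t - t) = u * (ePerm t * u⁻¹ * (ePerm t)⁻¹) := by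
        rw [sub_eq_add_neg, ← ePerm_mul, ← hα, ← ePerm_inv]
        simp only [mul_assoc]
      rw [this]
      exact mul_mem hu ((Subgroup.mem_normalizer_iff.1 (hB (hE (ePerm_mem t))) _).1 (inv_mem hu))
    have h2 := hab _ hu _ h1
    have h3 : α (α t - t) = α t - t := by
      apply eAct_injective
      intro v
      obtain ⟨w, rfl⟩ := u.surjective v
      rw [← hα']
      exact Equiv.congr_fun h2 w
    have h4 := hαadd (α t - t) t
    rw [sub_add_cancel, h3] at h4
    rw [h4]
    ring
  have hid := eq_id_of_quadratic two_ne_zero (AddMonoidHom.mk' α hαadd) hmul hquad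
  obtain ⟨s, hs, t, h⟩ := hD.eq_of_commute_eAct (p := p) hF u.injective hadd
    (fun t v => by rw [hα', show α t = t from hid t]) (hRD u huR)
  -- The order of u is a power of p, hence so is that of s², which must be 1 in characteristic p.
  obtain ⟨k, hk⟩ := hR ⟨u, huR⟩
  have hk' : u ^ p ^ k = 1 := congrArg Subtype.val hk
  have hpow : ∀ m : ℕ, ∀ v, (u ^ m) v 2 = (s * s) ^ m * v 2 := by
    intro m
    induction m with
    | zero => intro v; simp
    | succ m ih =>
      intro v
      rw [pow_succ', Equiv.Perm.mul_apply, h]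
      simp only [Pi.smul_apply, eAct_two_coord, ih, smul_eq_mul]
      ring
  have hs1 : (s * s) ^ p ^ k = 1 := by
    have := hpow (p ^ k) ![0, 0, 1]
    rw [hk'] at this
    simpa using this.symm
  have hss : s * s = 1 := by
    have := sub_pow_char_pow (s * s) 1 k (p := p)
    rw [hs1, one_pow, sub_self] at this
    exact sub_eq_zero.1 (eq_zero_of_pow_eq_zero this)
  refine ⟨t, ?_⟩
  ext1 v
  rw [h, hss, one_smul]
  rfl

end Unipotent

/-! ### The group A as permutations of V -/

section GroupAAction

variable {F : Type*} [Field F]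

theorem toPerm_toAddAut (a : GL (Fin 3) F) (v : V F) :
    AutV.toPerm (DistribMulAction.toAddAut (GL (Fin 3) F) (V F) a) v = a.1.mulVec v := rfl

theorem matE_mulVec (t : F) (v : V F) : (matE t).1.mulVec v = eAct t v := by
  change Matrix.mulVec !![1, t, t ^ 2 / 2; 0, 1, t; 0, 0, 1] v = _
  apply V.ext <;> simp [Matrix.mulVec, dotProduct, Fin.sum_univ_three]

theorem scalar_mulVec (s : Fˣ) (v : V F) :
    (Matrix.GeneralLinearGroup.scalar (Fin 3) s).1.mulVec v = (s : F) • v := by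
  change (Matrix.scalar (Fin 3) (s : F)).mulVec v = _
  rw [Matrix.scalar_apply]
  ext i
  rw [Matrix.mulVec_diagonal]
  rfl

/-- A centralizes E; among automorphisms preserving an invariant difference set,
`IsInvariantSHDS.eq_of_commute_eAct` gives the converse. -/
theorem commute_eAct_of_mem_groupAInAut (h2 : (2 : F) ≠ 0) {a : AutV F} (ha : a ∈ groupAInAut F)
    (t : F) (v : V F) :
    AutV.toPerm a (eAct t v) = eAct t (AutV.toPerm a v) := by
  obtain ⟨a, ha, rfl⟩ := ha
  have h : groupA F ≤ Subgroup.centralizer {matE t} := by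
    refine sup_le ((Subgroup.closure_le _).2 ?_) ?_
    · rintro _ ⟨s, rfl⟩
      rw [SetLike.mem_coe, Subgroup.mem_centralizer_singleton_iff]
      refine Units.ext (Matrix.toLin'.injective (LinearMap.ext fun w => ?_))
      simp only [Units.val_mul, Matrix.toLin'_mul, LinearMap.comp_apply, Matrix.toLin'_apply,
        matE_mulVec]
      rw [← eAct_add h2, ← eAct_add h2, add_comm]
    · rintro _ ⟨s, -, rfl⟩
      rw [Subgroup.mem_centralizer_singleton_iff]
      refine Units.ext (Matrix.toLin'.injective (LinearMap.ext fun w => ?_))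
      simp only [Units.val_mul, Matrix.toLin'_mul, LinearMap.comp_apply, Matrix.toLin'_apply,
        matE_mulVec, scalar_mulVec]
      rw [← matE_mulVec t (_ • w), Matrix.mulVec_smul, matE_mulVec]
  have h' := Subgroup.mem_centralizer_singleton_iff.1 (h ha)
  rw [toPerm_toAddAut, toPerm_toAddAut, ← matE_mulVec, ← matE_mulVec, Matrix.mulVec_mulVec,
    Matrix.mulVec_mulVec, ← Units.val_mul, ← Units.val_mul, h']

theorem mem_groupAInAut {a : AutV F} {s : F} (hs : s ≠ 0) {t : F}
    (h : ∀ v, AutV.toPerm a v = (s * s) • eAct t v) : a ∈ groupAInAut F := by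
  let u : Fˣ := Units.mk0 s hs
  refine ⟨Matrix.GeneralLinearGroup.scalar (Fin 3) (u * u) * matE t, mul_mem ?_ ?_, ?_⟩
  · exact Subgroup.mem_sup_right ⟨u * u, Subgroup.mem_square.2 ⟨u, rfl⟩, rfl⟩
  · exact Subgroup.mem_sup_left (Subgroup.subset_closure ⟨t, rfl⟩)
  · refine Multiplicative.toAdd.injective (AddEquiv.ext fun v => ?_)
    change (Matrix.GeneralLinearGroup.scalar (Fin 3) (u * u) * matE t).1.mulVec v =
      AutV.toPerm a v
    rw [Units.val_mul, ← Matrix.mulVec_mulVec, matE_mulVec, scalar_mulVec, h]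
    simp [u]

/-- The additive permutations of `V` are the elements of `Aut(V)`. -/
def autOfPerm (g : Equiv.Perm (V F)) (h : ∀ v w, g (v + w) = g v + g w) : AutV F :=
  Multiplicative.ofAdd { g with map_add' := h }

@[simp] theorem toPerm_autOfPerm (g : Equiv.Perm (V F)) (h : ∀ v w, g (v + w) = g v + g w) :
    AutV.toPerm (autOfPerm g h) = g := rfl

theorem toPerm_add (a : AutV F) (v w : V F) :
    AutV.toPerm a (v + w) = AutV.toPerm a v + AutV.toPerm a w :=
  (Multiplicative.toAdd a).map_add v w

theorem isInvariantSHDS_of_mem [Finite F] (h2 : (2 : F) ≠ 0) {D : Set (V F)}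
    (hD : D ∈ invariantSHDS F) : IsInvariantSHDS D where
  shds := hD.1
  eAct_mem := fun t v hv => by
    have : NeZero (2 : F) := ⟨h2⟩
    have h := hD.2 (autOfPerm (ePerm t) (eAct_add_vec t))
      (mem_groupAInAut one_ne_zero (t := t) fun w => by
        rw [mul_one, one_smul]
        rfl)
    rw [← h]
    exact ⟨v, hv, rfl⟩
  sq_smul_mem := fun s hs v hv => by
    let g : Equiv.Perm (V F) := MulAction.toPerm (Units.mk0 (s * s) (mul_ne_zero hs hs))
    have hg : ∀ w, g w = (s * s) • w := fun w => rfl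
    have h := hD.2 (autOfPerm g fun v w => by simp only [hg, smul_add])
      (mem_groupAInAut hs (t := 0) fun w => by simp [hg])
    rw [← h]
    exact ⟨v, hv, rfl⟩

end GroupAAction

/-! ### From an arbitrary isomorphism to one normalizing A -/

section Main

variable {F : Type*} [Field F] [Fintype F]

theorem containsAbelianNormal_translations [NeZero (2 : F)] {p : ℕ} [Fact p.Prime] [CharP F p]
    (hF : Fintype.card F % 4 = 3)
    {D : Set (V F)} (hD : IsInvariantSHDS D) {P : Subgroup (Equiv.Perm (V F))}
    (hP : IsPGroup p P) (hPD : P ≤ designAut (dev D)) (hT : translations (V F) ≤ P)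
    (hE : eSubgroup F ≤ P) : ContainsAbelianNormal P (translations (V F)) :=
  fun _ hBR hB hab => le_translations_of_abelian_normal hF hD (hP.to_le inf_le_left)
    (inf_le_left.trans hPD) inf_le_right (le_inf hT Subgroup.le_normalizer)
    (le_inf hE eSubgroup_le_normalizer) hBR hB hab

theorem containsAbelianNormal_eSubgroup [NeZero (2 : F)] {p : ℕ} [Fact p.Prime] [CharP F p]
    (hF : Fintype.card F % 4 = 3)
    {D : Set (V F)} (hD : IsInvariantSHDS D) {Q : Subgroup (Equiv.Perm (V F))}
    (hQ : IsPGroup p Q) (hQadd : ∀ f ∈ Q, ∀ v w, f (v + w) = f v + f w)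
    (hQD : ∀ f ∈ Q, f '' D = D) (hE : eSubgroup F ≤ Q) :
    ContainsAbelianNormal Q (eSubgroup F) :=
  fun _ hBR hB hab => le_eSubgroup_of_abelian_normal hF hD (hQ.to_le inf_le_left)
    (fun f hf => hQadd f hf.1) (fun f hf _ hv => hQD f hf.1 ▸ Set.mem_image_of_mem f hv)
    inf_le_right (le_inf hE Subgroup.le_normalizer) hBR hB hab

/-- Isomorphic translation designs of invariant difference sets are isomorphic by an additive
permutation that maps one difference set onto the other and normalizes `E`. -/
theorem exists_additive_iso_normalizing [NeZero (2 : F)] (p : ℕ) [Fact p.Prime] [CharP F p]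
    (hF : Fintype.card F % 4 = 3)
    {D D' : Set (V F)} (hD : IsInvariantSHDS D) (hD' : IsInvariantSHDS D')
    {g : Equiv.Perm (V F)} (hg : IsDesignIso g (dev D) (dev D')) :
    ∃ f : Equiv.Perm (V F), (∀ v w, f (v + w) = f v + f w) ∧ f '' D = D' ∧
      f ∈ Subgroup.normalizer (eSubgroup F : Set (Equiv.Perm (V F))) := by
  set T := translations (V F)
  set E := eSubgroup F
  have hTp : IsPGroup p T := isPGroup_translations fun v => by
    funext i
    simp
  have hX : IsPGroup p (E ⊔ T : Subgroup (Equiv.Perm (V F))) :=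
    isPGroup_eSubgroup.to_sup_of_normal_right' hTp eSubgroup_le_normalizer
  have hconj : ∀ {f x : Equiv.Perm (V F)}, IsDesignIso f (dev D) (dev D') →
      x ∈ designAut (dev D) → f * x * f⁻¹ ∈ designAut (dev D') := fun hf hx =>
    (hf.symm.trans hx).trans hf
  have hconj' : ∀ {f x : Equiv.Perm (V F)}, IsDesignIso f (dev D) (dev D') →
      f * x * f⁻¹ ∈ designAut (dev D') → x ∈ designAut (dev D) := fun {f x} hf hx => by
    have := (hf.trans hx).trans hf.symm
    have e : (f.trans (f * x * f⁻¹)).trans f.symm = x := by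
      ext1 v
      simp
    rwa [e] at this
  have hXD : ∀ {D : Set (V F)}, IsInvariantSHDS D → E ⊔ T ≤ designAut (dev D) := fun hD =>
    sup_le (eSubgroup_le_designAut hD) (translations_le_designAut _)
  -- Sylow's theorem in Aut(dev(D')): the automorphism c of dev(D') brings the g-conjugate of ET
  -- into a p-group containing ET.
  obtain ⟨P, hPD, hP, hXP, c, hc, hcP⟩ := exists_common_pSubgroup (p := p)
    (G := designAut (dev D')) hX (hX.map (MulAut.conj g).toMonoidHom) (hXD hD') (by
      rintro _ ⟨x, hx, rfl⟩
      exact hconj hg (hXD hD hx))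
  have hcg : IsDesignIso (c * g) (dev D) (dev D') := hg.trans hc
  have hcgP : ∀ x ∈ E ⊔ T, c * g * x * (c * g)⁻¹ ∈ P := fun x hx => by
    have := hcP _ ⟨x, hx, rfl⟩
    simpa [mul_assoc] using this
  have hTP : T ≤ P := le_sup_right.trans hXP
  have hEP : E ≤ P := le_sup_left.trans hXP
  have hTleX : T ≤ E ⊔ T := le_sup_right
  have hEleX : E ≤ E ⊔ T := le_sup_left
  obtain ⟨hPT, hcgT⟩ := mem_normalizer_of_containsAbelianNormal hP hTP translations_comm
    (containsAbelianNormal_translations hF hD' hP hPD hTP hEP) (g := c * g)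
    (fun x hx => hcgP x (hTleX hx))
    (containsAbelianNormal_translations hF hD
      (hP.comap_of_injective _ (MulAut.conj (c * g)).injective)
      (fun x hx => hconj' hcg (hPD hx)) (fun x hx => hcgP x (hTleX hx))
      (fun x hx => hcgP x (hEleX hx)))
  set τ : Equiv.Perm (V F) := Equiv.addRight (-((c * g) 0)) with hτ
  have hτT : τ ∈ T := addRight_mem_translations _
  set f := τ * (c * g) with hf
  have hf0 : f 0 = 0 := by simp [hf, hτ]
  have hfT : f ∈ Subgroup.normalizer (T : Set (Equiv.Perm (V F))) :=
    mul_mem (Subgroup.le_normalizer hτT) hcgT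
  have hfadd := map_add_of_mem_normalizer hfT hf0
  have hfiso : IsDesignIso f (dev D) (dev D') := hcg.trans (translations_le_designAut D' hτT)
  have himage : f '' D = D' := hD.shds.image_eq hD'.shds (three_lt_card_V hF)
    eq_zero_of_add_self hfadd hfiso
  refine ⟨f, hfadd, himage, ?_⟩
  -- Second round: the stabilizer of 0 in P is additive and preserves D', and E takes the role of T.
  let Q : Subgroup (Equiv.Perm (V F)) := P ⊓ MulAction.stabilizer (Equiv.Perm (V F)) (0 : V F)
  have hQ : IsPGroup p Q := hP.to_le inf_le_left
  have hQ0 : ∀ x ∈ Q, x 0 = 0 := fun x hx => hx.2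
  have hQadd : ∀ x ∈ Q, ∀ v w, x (v + w) = x v + x w := fun x hx =>
    map_add_of_mem_normalizer (hPT hx.1) hx.2
  have hQD : ∀ x ∈ Q, x '' D' = D' := fun x hx =>
    image_eq_of_mem_designAut hF hD' (hQadd x hx) (hPD hx.1)
  have hE0 : ∀ x ∈ E, x 0 = 0 := by
    rintro _ ⟨t, rfl⟩
    apply V.ext <;> simp
  have hf0' : f⁻¹ 0 = 0 := by
    rw [Equiv.Perm.inv_eq_iff_eq, hf0]
  have hfE : ∀ x ∈ E, f * x * f⁻¹ ∈ Q := fun x hx => by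
    refine ⟨?_, ?_⟩
    · have : f * x * f⁻¹ = τ * (c * g * x * (c * g)⁻¹) * τ⁻¹ := by
        rw [hf]
        group
      rw [this]
      exact P.mul_mem (P.mul_mem (hTP hτT) (hcgP x (hEleX hx))) (P.inv_mem (hTP hτT))
    · change f (x (f⁻¹ 0)) = 0
      rw [hf0', hE0 x hx, hf0]
  have hcomapT : ∀ x ∈ Q.comap (MulAut.conj f).toMonoidHom,
      x ∈ Subgroup.normalizer (T : Set (Equiv.Perm (V F))) := fun x hx => by
    have h1 : f * x * f⁻¹ ∈ Subgroup.normalizer (T : Set (Equiv.Perm (V F))) := hPT hx.1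
    have h2 := mul_mem (mul_mem (inv_mem hfT) h1) hfT
    simpa [mul_assoc] using h2
  have hcomapadd : ∀ x ∈ Q.comap (MulAut.conj f).toMonoidHom, ∀ v w, x (v + w) = x v + x w :=
    fun x hx => map_add_of_mem_normalizer (hcomapT x hx) (f.injective (by
      have := hQ0 _ hx
      change f (x (f⁻¹ 0)) = 0 at this
      rw [hf0'] at this
      rw [this, hf0]))
  exact (mem_normalizer_of_containsAbelianNormal hQ
    (fun x hx => ⟨hEP hx, hE0 x hx⟩) eSubgroup_comm
    (containsAbelianNormal_eSubgroup hF hD' hQ hQadd hQD fun x hx => ⟨hEP hx, hE0 x hx⟩)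
    hfE (containsAbelianNormal_eSubgroup hF hD
      (hQ.comap_of_injective _ (MulAut.conj f).injective) hcomapadd
      (fun x hx => image_eq_of_mem_designAut hF hD (hcomapadd x hx)
        (hconj' hfiso (hPD hx.1))) hfE)).2

/-- An automorphism of `V` that normalizes `E` and maps one invariant difference set onto another
normalizes `A`. -/
theorem mem_normalizer_groupAInAut [NeZero (2 : F)] (p : ℕ) [Fact p.Prime] [CharP F p]
    (hF : Fintype.card F % 4 = 3)
    {D D' : Set (V F)} (hD : D ∈ invariantSHDS F) (hD' : D' ∈ invariantSHDS F) {g : AutV F}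
    (hgD : AutV.toPerm g '' D = D')
    (hgE : AutV.toPerm g ∈ Subgroup.normalizer (eSubgroup F : Set (Equiv.Perm (V F)))) :
    g ∈ Subgroup.normalizer (groupAInAut F : Set (AutV F)) := by
  have : Finite (AutV F) := Finite.of_injective AutV.toPerm fun a b h =>
    Multiplicative.toAdd.injective (AddEquiv.ext fun v => Equiv.congr_fun h v)
  have hle : (groupAInAut F).map (MulAut.conj g).toMonoidHom ≤ groupAInAut F := by
    rintro _ ⟨a, ha, rfl⟩
    set f := AutV.toPerm g with hf
    -- As a centralizes E and f normalizes E, the conjugate centralizes E as well; it also preserves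
    -- D', which puts it in A.
    have hcomm : ∀ t v, (f * AutV.toPerm a * f⁻¹) (eAct t v) =
        eAct t ((f * AutV.toPerm a * f⁻¹) v) := by
      intro t v
      obtain ⟨w, rfl⟩ := f.surjective v
      obtain ⟨t', ht'⟩ := (Subgroup.mem_normalizer_iff''.1 hgE _).1 (ePerm_mem t)
      have h1 : ∀ x, eAct t (f x) = f (eAct t' x) := fun x => by
        have := Equiv.congr_fun (inv_mul_eq_iff_eq_mul.1 ((mul_assoc _ _ _).symm.trans ht')) x
        exact this
      have h3 : ∀ x, (f * AutV.toPerm a * f⁻¹) (f x) = f (AutV.toPerm a x) := fun x => by simp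
      rw [h1, h3, h3, h1, commute_eAct_of_mem_groupAInAut two_ne_zero ha]
    have himage : ∀ v ∈ D', (f * AutV.toPerm a * f⁻¹) v ∈ D' := by
      intro v hv
      rw [← hgD] at hv ⊢
      obtain ⟨w, hw, rfl⟩ := hv
      refine ⟨AutV.toPerm a w, ?_, by simp⟩
      rw [← hD.2 a ha]
      exact ⟨w, hw, rfl⟩
    obtain ⟨s, hs, t, h⟩ := (isInvariantSHDS_of_mem two_ne_zero hD').eq_of_commute_eAct (p := p) hF
      (f * AutV.toPerm a * f⁻¹).injective (toPerm_add (g * a * g⁻¹)) hcomm himage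
    exact mem_groupAInAut hs (t := t) h
  rw [Subgroup.mem_normalizer_iff_map_conj_eq]
  refine Subgroup.eq_of_le_of_card_ge hle ?_
  rw [Subgroup.card_map_of_injective (MulAut.conj g).injective]

end Main

end SkewHadamard

theorem theorem6p1 (p n : ℕ) (hp : p.Prime) (hp4 : p % 4 = 3) (hn : Odd n)
    (F : Type*) [Field F] [Finite F] (hF : Nat.card F = p ^ n)
    (D D' : Set (SkewHadamard.V F))
    (hD : D ∈ SkewHadamard.invariantSHDS F) (hD' : D' ∈ SkewHadamard.invariantSHDS F) :
    SkewHadamard.DesignsIsomorphic (SkewHadamard.dev D) (SkewHadamard.dev D') ↔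
      ∃ g ∈ Subgroup.normalizer (SkewHadamard.groupAInAut F : Set (SkewHadamard.AutV F)),
        SkewHadamard.IsDesignIso (SkewHadamard.AutV.toPerm g)
          (SkewHadamard.dev D) (SkewHadamard.dev D') := by
  refine ⟨?_, fun ⟨g, _, hg⟩ => ⟨_, hg⟩⟩
  rintro ⟨g, hg⟩
  have : Fintype F := Fintype.ofFinite F
  have : Fact p.Prime := ⟨hp⟩
  have hcard : Fintype.card F = p ^ n := by rw [← Nat.card_eq_fintype_card, hF]
  have : CharP F p := charP_of_card_eq_prime_pow hcard
  have hF4 : Fintype.card F % 4 = 3 := by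
    obtain ⟨m, rfl⟩ := hn
    rw [hcard, Nat.pow_mod, hp4, pow_succ, pow_mul, Nat.mul_mod, Nat.pow_mod]
    simp
  have : NeZero (2 : F) := ⟨SkewHadamard.two_ne_zero_of_card hF4⟩
  obtain ⟨f, hfadd, himage, hfE⟩ := SkewHadamard.exists_additive_iso_normalizing p hF4
    (SkewHadamard.isInvariantSHDS_of_mem two_ne_zero hD)
    (SkewHadamard.isInvariantSHDS_of_mem two_ne_zero hD') hg
  exact ⟨SkewHadamard.autOfPerm f hfadd,
    SkewHadamard.mem_normalizer_groupAInAut p hF4 hD hD' himage hfE,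
    SkewHadamard.isDesignIso_of_image_eq hfadd himage⟩
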